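/- Let $G$ be a countable discrete group and let $\sigma_i\colon G\to S_{d_i}$ ($i\in\mathbb N$, $d_i\ge 1$) be a sofic approximation of $G$, i.e. with $u_d$ the uniform probability measure on $\{1,\dots,d\}$, $u_{d_i}(\{j:\sigma_i(g)\sigma_i(h)(j)=\sigma_i(gh)(j)\})\to1$ for all $g,h\in G$ and $u_{d_i}(\{j:\sigma_i(g)(j)\neq j\})\to1$ for all $g\in G\setminus\{e\}$. Definitions. A probability space is standard if its completion is isomorphic, modulo null sets, to the completion of a Borel probability measure on a standard Borel space; below, measurability of maps and sets refers to completions. Let $G$ act by homeomorphisms on a compact metrizable space $Z$, and let $\mu$ be a $G$-invariant Borel probability measure on $Z$. A continuous pseudometric $\rho$ on $Z$ is dynamically generating if for all $x\ne y$ in $Z$ there is $g\in G$ with $\rho(gx,gy)>0$. Borel probability measures $\mu_i$ on $Z^{d_i}$ converge locally and empirically to $\mu$ if, for some dynamically generating continuous pseudometric $\rho$ on $Z$: (a) $u_{d_i}\big(\{j:|\int f(x(j))\,d\mu_i(x)-\int f\,d\mu|<\kappa\}\big)\to1$ for all $f\in C(Z)$ and $\kappa>0$; (b) for all finite $F\subseteq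 G$, $L\subseteq C(Z)$ and all $\delta>0$, the $\mu_i$-measure of the set of $\phi\in Z^{d_i}$ such that $\big(\frac1{d_i}\sum_j\rho(g\phi(j),\phi(\sigma_i(g)(j)))^2\big)^{1/2}<\delta$ for all $g\in F$ and $|\int f\,d\mu-\frac1{d_i}\sum_jf(\phi(j))|<\delta$ for all $f\in L$ tends to $1$. They converge locally and doubly empirically to $\mu$ if $\mu_i\otimes\mu_i$, viewed on $(Z\times Z)^{d_i}$, converges locally and empirically to $\mu\otimes\mu$ for the diagonal action on $Z\times Z$. A probability measure-preserving action of $G$ on a standard probability space is strongly sofic (with respect to $(\sigma_i)_i$) if it is isomorphic, modulo null sets, to some $G\curvearrowright(Z,\mu)$ as above for which there are $\mu_i\in\mathrm{Prob}(Z^{d_i})$ converging locally and doubly empirically to $\mu$. Theorem. (i) Let $G\curvearrowright(Y_\alpha,\nu_\alpha)$ be an inverse system, indexed by a nonempty directed set (for instance $\mathbb N$), of probability measure-preserving actions on standard probability spaces, the connecting maps being measure-preserving, almost everywhere equivariant and almost everywhere compatible. Let the probability measure-preserving action $G\curvearrowright(X,\mu)$, with $(X,\mu)$ standard, be its inverse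 limit: there are measure-preserving, almost everywhere equivariant maps $X\to Y_\alpha$ which are almost everywhere compatible with the connecting maps and which together generate the $\sigma$-algebra of $X$ modulo null sets. If every $G\curvearrowright(Y_\alpha,\nu_\alpha)$ is strongly sofic with respect to $(\sigma_i)_i$, then so is $G\curvearrowright(X,\mu)$. (ii) Let $G\curvearrowright(X,\mu)$ and $G\curvearrowright(Y,\nu)$ be probability measure-preserving actions on standard probability spaces, and suppose that $G\curvearrowright(Y,\nu)$ is weakly contained in $G\curvearrowright(X,\mu)$: for all $n$, all measurable $A_1,\dots,A_n\subseteq Y$, all finite $F\subseteq G$ and all $\varepsilon>0$ there are measurable $B_1,\dots,B_n\subseteq X$ with $|\nu(gA_k\cap A_l)-\mu(gB_k\cap B_l)|<\varepsilon$ for all $g\in F$ and all $k,l$. If $G\curvearrowright(X,\mu)$ is strongly sofic with respect to $(\sigma_i)_i$, then so is $G\curvearrowright(Y,\nu)$. -/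

import Mathlib

open MeasureTheory Filter Topology
open scoped Pointwise

/-- The normalized counting (uniform) measure `u_d` of a subset of `{1, …, d}`. -/
noncomputable def uniformFraction (d : ℕ) (s : Set (Fin d)) : ℝ :=
  (s.ncard : ℝ) / (d : ℝ)

/-- A sequence of maps `σ i : G → S_{d i}` (not assumed to be homomorphisms) is a sofic
approximation of `G` if it is asymptotically multiplicative and asymptotically free. -/
structure IsSoficApproximation {G : Type*} [Group G] {d : ℕ → ℕ}
    (σ : ∀ i, G → Equiv.Perm (Fin (d i))) : Prop where
  pos : ∀ i, 0 < d i
  mul : ∀ g h : G, Tendsto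
    (fun i => uniformFraction (d i) {j | σ i g (σ i h j) = σ i (g * h) j}) atTop (𝓝 1)
  free : ∀ g : G, g ≠ 1 → Tendsto
    (fun i => uniformFraction (d i) {j | σ i g j ≠ j}) atTop (𝓝 1)

/-! ### Probability spaces up to null sets -/

/-- `f` is a measurable, measure-preserving map between the completions of `(X, μ)`
and `(Y, ν)`. -/
structure NullMeasurePreserving {X Y : Type*} [MeasurableSpace X] [MeasurableSpace Y]
    (f : X → Y) (μ : Measure X) (ν : Measure Y) : Prop where
  nullMeasurableSet_preimage : ∀ B : Set Y, NullMeasurableSet B ν → NullMeasurableSet (f ⁻¹' B) μ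
  measure_preimage : ∀ B : Set Y, NullMeasurableSet B ν → μ (f ⁻¹' B) = ν B

/-- `f` and `g` are mutually inverse isomorphisms modulo null sets between the completions of
`(X, μ)` and `(Y, ν)`. -/
structure IsIsoModNull {X Y : Type*} [MeasurableSpace X] [MeasurableSpace Y]
    (f : X → Y) (g : Y → X) (μ : Measure X) (ν : Measure Y) : Prop where
  map : NullMeasurePreserving f μ ν
  inv : NullMeasurePreserving g ν μ
  left_inv : ∀ᵐ x ∂μ, g (f x) = x
  right_inv : ∀ᵐ y ∂ν, f (g y) = y

/-- A standard probability space: its completion is isomorphic modulo null sets to the completion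
of a Borel probability measure on a standard Borel space. (Every standard Borel space has at most
continuum many points, so restricting to `Type` loses nothing.) -/
def IsStandardProbability {X : Type*} [MeasurableSpace X] (μ : Measure X) : Prop :=
  IsProbabilityMeasure μ ∧
    ∃ (Y : Type) (_ : MeasurableSpace Y) (_ : StandardBorelSpace Y) (ν : Measure Y)
      (f : X → Y) (g : Y → X), IsProbabilityMeasure ν ∧ IsIsoModNull f g μ ν

/-- A probability measure-preserving action of `G` on a standard probability space `(X, μ)`. -/
structure IsPMPAction (G : Type*) [Group G] {X : Type*} [MeasurableSpace X] [MulAction G X]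
    (μ : Measure X) : Prop where
  standard : IsStandardProbability μ
  measurePreserving : ∀ g : G, NullMeasurePreserving (fun x : X => g • x) μ μ

/-- A factor map `G ↷ (X, μ) → G ↷ (Y, ν)`: measure-preserving and almost everywhere
equivariant. -/
structure IsFactorMap (G : Type*) [Group G] {X Y : Type*} [MeasurableSpace X] [MeasurableSpace Y]
    [MulAction G X] [MulAction G Y] (f : X → Y) (μ : Measure X) (ν : Measure Y) : Prop where
  measurePreserving : NullMeasurePreserving f μ ν
  equivariant : ∀ g : G, ∀ᵐ x ∂μ, f (g • x) = g • f x

/-- The actions `G ↷ (X, μ)` and `G ↷ (Y, ν)` are isomorphic as measure-preserving systems. -/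
def ActionsIsomorphic (G : Type*) [Group G] {X Y : Type*} [MeasurableSpace X] [MeasurableSpace Y]
    [MulAction G X] [MulAction G Y] (μ : Measure X) (ν : Measure Y) : Prop :=
  ∃ (f : X → Y) (g : Y → X), IsIsoModNull f g μ ν ∧ IsFactorMap G f μ ν

/-! ### Inverse limits and weak containment -/

/-- An inverse system of measure-preserving actions of `G` indexed by `ι`. -/
structure IsInverseSystem (G : Type*) [Group G] {ι : Type*} [Preorder ι] {X : ι → Type*}
    [∀ i, MeasurableSpace (X i)] [∀ i, MulAction G (X i)] (μ : ∀ i, Measure (X i))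
    (p : ∀ i j, i ≤ j → X j → X i) : Prop where
  factor : ∀ i j (h : i ≤ j), IsFactorMap G (p i j h) (μ j) (μ i)
  id : ∀ i, ∀ᵐ x ∂(μ i), p i i le_rfl x = x
  comp : ∀ i j k (hij : i ≤ j) (hjk : j ≤ k),
    ∀ᵐ x ∂(μ k), p i j hij (p j k hjk x) = p i k (hij.trans hjk) x

/-- `G ↷ (Y, ν)`, with the projections `π i`, is the inverse limit of the inverse system
`(X i, μ i)` with connecting maps `p`: the projections are factor maps compatible with the
connecting maps, and together they generate the sigma-algebra of `Y` modulo null sets. -/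
structure IsInverseLimit (G : Type*) [Group G] {ι : Type*} [Preorder ι] {X : ι → Type*}
    [mX : ∀ i, MeasurableSpace (X i)] [∀ i, MulAction G (X i)] (μ : ∀ i, Measure (X i))
    (p : ∀ i j, i ≤ j → X j → X i) {Y : Type*} [MeasurableSpace Y] [MulAction G Y]
    (ν : Measure Y) (π : ∀ i, Y → X i) : Prop where
  system : IsInverseSystem G μ p
  factor : ∀ i, IsFactorMap G (π i) ν (μ i)
  compatible : ∀ i j (h : i ≤ j), ∀ᵐ y ∂ν, p i j h (π j y) = π i y
  generates : ∀ A : Set Y, NullMeasurableSet A ν →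
    ∃ B : Set Y, MeasurableSet[⨆ i, (mX i).comap (π i)] B ∧ A =ᵐ[ν] B

/-- `G ↷ (Y, ν)` is weakly contained in `G ↷ (X, μ)`: for measurable `A 1, …, A n ⊆ Y`, a
finite `F ⊆ G` and `ε > 0` there are measurable `B 1, …, B n ⊆ X` such that
`|ν (g A k ∩ A l) - μ (g B k ∩ B l)| < ε` for all `g ∈ F` and all `k, l`. -/
def WeaklyContained (G : Type*) [Group G] {X Y : Type*} [MeasurableSpace X] [MeasurableSpace Y]
    [MulAction G X] [MulAction G Y] (ν : Measure Y) (μ : Measure X) : Prop :=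
  ∀ (n : ℕ) (A : Fin n → Set Y), (∀ k, NullMeasurableSet (A k) ν) →
    ∀ (F : Finset G) (ε : ℝ), 0 < ε →
      ∃ B : Fin n → Set X, (∀ k, NullMeasurableSet (B k) μ) ∧
        ∀ g ∈ F, ∀ k l, |ν.real ((g • A k) ∩ A l) - μ.real ((g • B k) ∩ B l)| < ε

/-! ### Local and doubly empirical convergence -/

/-- A continuous pseudometric `ρ` on `X` is dynamically generating for `G ↷ X` if for all
`x ≠ y` there is `g` with `ρ (g x, g y) > 0`. -/
structure IsDynGenerating (G : Type*) [Group G] {X : Type*} [TopologicalSpace X] [MulAction G X]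
    (ρ : PseudoMetric X ℝ) : Prop where
  continuous : Continuous fun q : X × X => ρ q.1 q.2
  generating : ∀ x y : X, x ≠ y → ∃ g : G, 0 < ρ (g • x) (g • y)

/-- The pseudometric `ρ₂` on `X ^ d`. -/
noncomputable def rhoTwo {X : Type*} (ρ : PseudoMetric X ℝ) {d : ℕ} (x y : Fin d → X) : ℝ :=
  Real.sqrt ((∑ j, ρ (x j) (y j) ^ 2) / (d : ℝ))

/-- The measure-theoretic microstates `Map_μ(ρ, F, L, δ, τ)`: those `φ ∈ X ^ d` that are
approximately equivariant and whose empirical distribution is close to `μ`. -/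
def measMicrostates {G : Type*} [Group G] {X : Type*} [TopologicalSpace X] [MeasurableSpace X]
    [MulAction G X] (μ : Measure X) (ρ : PseudoMetric X ℝ) (F : Finset G) (L : Finset C(X, ℝ))
    (δ : ℝ) {d : ℕ} (τ : G → Equiv.Perm (Fin d)) : Set (Fin d → X) :=
  {φ | (∀ g ∈ F, rhoTwo ρ (fun j => g • φ j) (fun j => φ (τ g j)) < δ) ∧
    ∀ f ∈ L, |(∫ x, f x ∂μ) - (∑ j, f (φ j)) / (d : ℝ)| < δ}

/-- Local and empirical convergence of `μs i ∈ Prob (X ^ (d i))` to `μ`. -/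
def LocallyEmpiricallyConverges {G : Type*} [Group G] {d : ℕ → ℕ}
    (σ : ∀ i, G → Equiv.Perm (Fin (d i))) {X : Type*} [TopologicalSpace X] [MeasurableSpace X]
    [MulAction G X] (μs : ∀ i, Measure (Fin (d i) → X)) (μ : Measure X) : Prop :=
  ∃ ρ : PseudoMetric X ℝ, IsDynGenerating G ρ ∧
    (∀ (f : C(X, ℝ)) (κ : ℝ), 0 < κ → Tendsto
      (fun i => uniformFraction (d i) {j | |(∫ x, f (x j) ∂(μs i)) - ∫ x, f x ∂μ| < κ})
      atTop (𝓝 1)) ∧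
    (∀ (F : Finset G) (L : Finset C(X, ℝ)) (δ : ℝ), 0 < δ → Tendsto
      (fun i => μs i (measMicrostates μ ρ F L δ (σ i))) atTop (𝓝 1))

/-- Local and doubly empirical convergence: `μs i ⊗ μs i`, regarded as a measure on
`(X × X) ^ (d i)`, locally and empirically converges to `μ ⊗ μ` for the diagonal action. -/
def LocallyDoublyEmpiricallyConverges {G : Type*} [Group G] {d : ℕ → ℕ}
    (σ : ∀ i, G → Equiv.Perm (Fin (d i))) {X : Type*} [TopologicalSpace X] [MeasurableSpace X]
    [MulAction G X] (μs : ∀ i, Measure (Fin (d i) → X)) (μ : Measure X) : Prop :=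
  LocallyEmpiricallyConverges σ
    (fun i => ((μs i).prod (μs i)).map fun q j => ((q.1 j, q.2 j) : X × X)) (μ.prod μ)

/-- `G ↷ (X, μ)` is strongly sofic with respect to `σ`: it has a compact model `G ↷ (Y, ν)`
(a compact metrizable space with an action by homeomorphisms and an invariant Borel probability
measure, isomorphic to `G ↷ (X, μ)`) and there are `νs i ∈ Prob (Y ^ (d i))` which locally and
doubly empirically converge to `ν`. (Compact metrizable spaces have at most continuum many points,
so restricting to `Type` loses nothing.) -/
def IsStronglySofic {G : Type*} [Group G] {d : ℕ → ℕ} (σ : ∀ i, G → Equiv.Perm (Fin (d i)))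
    {X : Type*} [MeasurableSpace X] [MulAction G X] (μ : Measure X) : Prop :=
  ∃ (Y : Type) (_ : TopologicalSpace Y) (_ : CompactSpace Y) (_ : TopologicalSpace.MetrizableSpace Y)
    (_ : MeasurableSpace Y) (_ : BorelSpace Y) (_ : MulAction G Y) (_ : ContinuousConstSMul G Y)
    (ν : Measure Y),
    IsProbabilityMeasure ν ∧ SMulInvariantMeasure G Y ν ∧ ActionsIsomorphic G μ ν ∧
      ∃ νs : ∀ i, Measure (Fin (d i) → Y), (∀ i, IsProbabilityMeasure (νs i)) ∧
        LocallyDoublyEmpiricallyConverges σ νs ν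

/-! Strong soficity asks for a good compact model. The proof replaces it by a condition on all
measurable functions at once. A function θ from X to the unit interval has an itinerary x ↦
(θ(gx))_g in the full shift, hence an itinerary law. Call a law `IsApproximable` if each finite list
of requirements in doubly empirical convergence can be met, for all large i, by some probability
measure on labelings. Then an action is strongly sofic exactly when all its itinerary laws are
approximable.

If all laws are approximable, take θ injective modulo null sets, which exists by standardness. Its
itinerary is an isomorphism onto a shift model, and a diagonal argument assembles the convergent
measures (`IsPMPAction.isStronglySofic_of_isApproximable`). Conversely, for continuous θ on a
compact model, push the given measures forward by the itinerary; approximate equivariance survives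
because a dynamically generating pseudometric controls every continuous one. General θ follow by
approximation in measure, under which approximability is closed (`IsStronglySofic.isApproximable`,
`isApproximable_itineraryLaw_of_forall_close`).

Both parts are now approximation statements. In an inverse limit, every θ is close in measure to a
function pulled back from one stage, whose law is that of a function on the stage. Under weak
containment, every θ is close to a finite labeling, a continuous test function almost depends on
finitely many coordinates, and finite-window pattern statistics can be copied from Y to X; so the
law is a limit of itinerary laws of X. -/

/-! ### Measure-preserving maps modulo null sets. -/

namespace NullMeasurePreserving

variable {X Y S : Type*} [MeasurableSpace X] [MeasurableSpace Y] [MeasurableSpace S]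
  {f : X → Y} {μ : Measure X} {ν : Measure Y}

theorem ae (hf : NullMeasurePreserving f μ ν) {p : Y → Prop} (hp : ∀ᵐ y ∂ν, p y) :
    ∀ᵐ x ∂μ, p (f x) := by
  have h0 : ν {y | ¬ p y} = 0 := hp
  have := hf.measure_preimage _ (NullMeasurableSet.of_null h0)
  rw [h0] at this
  exact this

theorem ae_iff (hf : NullMeasurePreserving f μ ν) {p : Y → Prop}
    (hp : NullMeasurableSet {y | p y} ν) (h : ∀ᵐ x ∂μ, p (f x)) : ∀ᵐ y ∂ν, p y := by
  have := hf.measure_preimage _ hp.compl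
  have h0 : μ (f ⁻¹' {y | p y}ᶜ) = 0 := h
  rw [h0] at this
  exact this.symm

theorem nullMeasurable (hf : NullMeasurePreserving f μ ν) {θ : Y → S} (hθ : AEMeasurable θ ν) :
    NullMeasurable (θ ∘ f) μ := fun _ hB =>
  hf.nullMeasurableSet_preimage _ (hθ.nullMeasurable hB)

/-- Countable generation of the target is what upgrades null measurability to almost everywhere
equality with a measurable map. -/
theorem aemeasurable_comp [MeasurableSpace.CountablyGenerated S] (hf : NullMeasurePreserving f μ ν)
    {θ : Y → S} (hθ : AEMeasurable θ ν) : AEMeasurable (θ ∘ f) μ :=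
  (hf.nullMeasurable hθ).aemeasurable

theorem map_comp [MeasurableSpace.CountablyGenerated S] (hf : NullMeasurePreserving f μ ν)
    {θ : Y → S} (hθ : AEMeasurable θ ν) : μ.map (θ ∘ f) = ν.map θ := by
  ext B hB
  rw [Measure.map_apply_of_aemeasurable (hf.aemeasurable_comp hθ) hB,
    Measure.map_apply_of_aemeasurable hθ hB, Set.preimage_comp,
    hf.measure_preimage _ (hθ.nullMeasurable hB)]

theorem comp {g : Y → S} {ξ : Measure S} (hg : NullMeasurePreserving g ν ξ)
    (hf : NullMeasurePreserving f μ ν) : NullMeasurePreserving (g ∘ f) μ ξ where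
  nullMeasurableSet_preimage B hB :=
    hf.nullMeasurableSet_preimage _ (hg.nullMeasurableSet_preimage B hB)
  measure_preimage B hB := by
    rw [Set.preimage_comp, hf.measure_preimage _ (hg.nullMeasurableSet_preimage B hB),
      hg.measure_preimage B hB]

theorem of_aemeasurable (hf : AEMeasurable f μ) (h : μ.map f = ν) :
    NullMeasurePreserving f μ ν := by
  subst h
  refine ⟨fun B hB => ?_, fun B hB => (Measure.map_apply₀ hf hB).symm⟩
  exact hB.preimage ⟨hf.measurable_mk, by rw [Measure.map_congr hf.ae_eq_mk]⟩ |>.congr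
    (hf.ae_eq_mk.symm.preimage B)

theorem isProbabilityMeasure (hf : NullMeasurePreserving f μ ν) [IsProbabilityMeasure μ] :
    IsProbabilityMeasure ν :=
  ⟨by rw [← hf.measure_preimage _ nullMeasurableSet_univ]; simp⟩

end NullMeasurePreserving

/-! ### The full shift. -/

/-- The full shift over `G` with alphabet the unit interval. -/
def ShiftSpace (G : Type*) [Countable G] : Type := Shrink.{0} G → unitInterval

namespace ShiftSpace

section Topology

variable (G : Type*) [Countable G]

/-- The coordinates are indexed by a copy of `G` in universe 0 because `IsStronglySofic` asks for a
model in `Type`. -/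
instance : Countable (Shrink.{0} G) := (equivShrink.{0} G).symm.injective.countable

instance : UniformSpace (ShiftSpace G) :=
  inferInstanceAs (UniformSpace (Shrink.{0} G → unitInterval))

instance : CompactSpace (ShiftSpace G) :=
  inferInstanceAs (CompactSpace (Shrink.{0} G → unitInterval))

instance : T2Space (ShiftSpace G) :=
  inferInstanceAs (T2Space (Shrink.{0} G → unitInterval))

instance : SecondCountableTopology (ShiftSpace G) :=
  inferInstanceAs (SecondCountableTopology (Shrink.{0} G → unitInterval))

instance : MeasurableSpace (ShiftSpace G) :=
  inferInstanceAs (MeasurableSpace (Shrink.{0} G → unitInterval))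

instance : BorelSpace (ShiftSpace G) :=
  inferInstanceAs (BorelSpace (Shrink.{0} G → unitInterval))

end Topology

variable {G : Type*} [Countable G]

/-- The coordinate of a point of the shift at a group element. -/
noncomputable def eval (g : G) (z : ShiftSpace G) : unitInterval := z (equivShrink.{0} G g)

/-- The point of the shift with given coordinates. -/
noncomputable def mk (u : G → unitInterval) : ShiftSpace G := fun h => u ((equivShrink.{0} G).symm h)

@[simp] theorem eval_mk (u : G → unitInterval) (g : G) : eval g (mk u) = u g := by
  simp [eval, mk]

theorem ext {z w : ShiftSpace G} (h : ∀ g, eval g z = eval g w) : z = w := by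
  funext k
  simpa [eval] using h ((equivShrink.{0} G).symm k)

theorem continuous_eval (g : G) : Continuous (eval g) := continuous_apply (equivShrink.{0} G g)

theorem continuous_of_eval {W : Type*} [TopologicalSpace W] {f : W → ShiftSpace G}
    (h : ∀ g, Continuous fun w => eval g (f w)) : Continuous f :=
  continuous_pi fun k => by simpa [eval] using h ((equivShrink.{0} G).symm k)

theorem aemeasurable_of_eval {W : Type*} [MeasurableSpace W] {ξ : Measure W} {f : W → ShiftSpace G}
    (h : ∀ g, AEMeasurable (fun w => eval g (f w)) ξ) : AEMeasurable f ξ :=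
  aemeasurable_pi_lambda (δ := Shrink.{0} G) (X := fun _ => unitInterval) f fun k => by
    simpa [eval] using h ((equivShrink.{0} G).symm k)

theorem tendsto_of_eval {W : Type*} {l : Filter W} {f : W → ShiftSpace G} {z : ShiftSpace G}
    (h : ∀ g, Tendsto (fun w => eval g (f w)) l (𝓝 (eval g z))) : Tendsto f l (𝓝 z) :=
  tendsto_pi_nhds (A := fun _ : Shrink.{0} G => unitInterval) |>.2 fun k => by
    simpa [eval] using h ((equivShrink.{0} G).symm k)

variable [Group G]

/-- Right translation of coordinates gives a left action, and makes x ↦ (θ(gx))_g equivariant. -/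
noncomputable instance : MulAction G (ShiftSpace G) where
  smul g z := mk fun h => eval (h * g) z
  one_smul z := by apply ext; intro h; change eval h (mk _) = _; simp
  mul_smul a b z := by
    apply ext; intro h
    change eval h (mk _) = eval h (mk fun h => eval (h * a) (mk _))
    simp [mul_assoc]

@[simp] theorem eval_smul (g h : G) (z : ShiftSpace G) : eval h (g • z) = eval (h * g) z :=
  eval_mk _ _

instance : ContinuousConstSMul G (ShiftSpace G) where
  continuous_const_smul g := continuous_of_eval fun h => by
    simpa using continuous_eval (h * g)

end ShiftSpace

/-! ### Itineraries and their laws. -/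

section Itinerary

variable {G : Type*} [Countable G] [Group G] {X : Type*} [MulAction G X]

/-- The `G`-equivariant map from `X` to the shift determined by a function on `X`. -/
noncomputable def itinerary (G : Type*) [Countable G] [Group G] {X : Type*} [MulAction G X]
    (θ : X → unitInterval) (x : X) : ShiftSpace G :=
  ShiftSpace.mk fun g => θ (g • x)

@[simp] theorem eval_itinerary (θ : X → unitInterval) (x : X) (g : G) :
    ShiftSpace.eval g (itinerary G θ x) = θ (g • x) := ShiftSpace.eval_mk _ _

theorem itinerary_smul (θ : X → unitInterval) (g : G) (x : X) :
    itinerary G θ (g • x) = g • itinerary G θ x := by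
  apply ShiftSpace.ext; intro h; simp [mul_smul]

variable [MeasurableSpace X] {μ : Measure X}

/-- The law of the itinerary of a function. -/
noncomputable def itineraryLaw (G : Type*) [Countable G] [Group G] {X : Type*} [MulAction G X]
    [MeasurableSpace X] (μ : Measure X) (θ : X → unitInterval) : Measure (ShiftSpace G) :=
  μ.map (itinerary G θ)

theorem aemeasurable_itinerary (hμ : ∀ g : G, NullMeasurePreserving (fun x : X => g • x) μ μ)
    {θ : X → unitInterval} (hθ : AEMeasurable θ μ) : AEMeasurable (itinerary G θ) μ :=
  ShiftSpace.aemeasurable_of_eval fun g => by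
    simpa [Function.comp_def] using (hμ g).aemeasurable_comp hθ

theorem nullMeasurePreserving_itinerary
    (hμ : ∀ g : G, NullMeasurePreserving (fun x : X => g • x) μ μ)
    {θ : X → unitInterval} (hθ : AEMeasurable θ μ) :
    NullMeasurePreserving (itinerary G θ) μ (itineraryLaw G μ θ) :=
  .of_aemeasurable (aemeasurable_itinerary hμ hθ) rfl

theorem smulInvariant_itineraryLaw (hμ : ∀ g : G, NullMeasurePreserving (fun x : X => g • x) μ μ)
    {θ : X → unitInterval} (hθ : AEMeasurable θ μ) :
    SMulInvariantMeasure G (ShiftSpace G) (itineraryLaw G μ θ) := by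
  refine ⟨fun g B hB => ?_⟩
  have h := nullMeasurePreserving_itinerary hμ hθ
  have hg : MeasurableSet ((fun z : ShiftSpace G => g • z) ⁻¹' B) := hB.preimage (by fun_prop)
  rw [← h.measure_preimage _ hg.nullMeasurableSet, ← h.measure_preimage _ hB.nullMeasurableSet,
    ← (hμ g).measure_preimage _ (h.nullMeasurableSet_preimage _ hB.nullMeasurableSet)]
  congr 1
  ext x
  simp [itinerary_smul]

theorem itineraryLaw_congr (hμ : ∀ g : G, NullMeasurePreserving (fun x : X => g • x) μ μ)
    {θ θ' : X → unitInterval} (h : θ =ᵐ[μ] θ') : itineraryLaw G μ θ = itineraryLaw G μ θ' := by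
  refine Measure.map_congr ?_
  filter_upwards [ae_all_iff.2 fun g => (hμ g).ae h] with x hx
  apply ShiftSpace.ext; intro g; simpa using hx g

/-- Countability of `G` makes `π` equivariant for all group elements off one null set. This lets
stages of an inverse limit and compact models supply laws for functions on `X`. -/
theorem itineraryLaw_comp {Y : Type*} [MulAction G Y] [MeasurableSpace Y] {ν : Measure Y}
    (hν : ∀ g : G, NullMeasurePreserving (fun x : Y => g • x) ν ν) {π : X → Y}
    (hπ : IsFactorMap G π μ ν) {θ : Y → unitInterval} (hθ : AEMeasurable θ ν) :
    itineraryLaw G μ (θ ∘ π) = itineraryLaw G ν θ := by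
  rw [itineraryLaw, itineraryLaw,
    ← hπ.measurePreserving.map_comp (aemeasurable_itinerary hν hθ)]
  refine Measure.map_congr ?_
  filter_upwards [ae_all_iff.2 hπ.equivariant] with x hx
  apply ShiftSpace.ext; intro g; simp [hx g]

end Itinerary

/-! ### Shift models of standard actions. -/

section Model

variable {G : Type*} [Countable G] [Group G] {X : Type*} [MulAction G X] [MeasurableSpace X]
  {μ : Measure X}

/-- A measure-preserving action on a standard probability space is isomorphic to the itinerary
shift of some function. -/
theorem IsPMPAction.exists_actionsIsomorphic_itineraryLaw (h : IsPMPAction G μ) :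
    ∃ θ : X → unitInterval, AEMeasurable θ μ ∧ ActionsIsomorphic G μ (itineraryLaw G μ θ) := by
  obtain ⟨hprob, Y, _, _, ν, φ, φ', hν, hφ⟩ := h.standard
  have hY : Nonempty Y := nonempty_of_isProbabilityMeasure ν
  set ψ := unitInterval.sigmoid ∘ embeddingReal Y with hψdef
  have hψ : MeasurableEmbedding ψ := measurableEmbedding_sigmoid_comp_embeddingReal Y
  have hθ : AEMeasurable (ψ ∘ φ) μ := hφ.map.aemeasurable_comp hψ.measurable.aemeasurable
  refine ⟨ψ ∘ φ, hθ, ?_⟩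
  have hΦ := nullMeasurePreserving_itinerary h.measurePreserving hθ
  set Φ := itinerary G (ψ ∘ φ) with hΦdef
  have hinv : NullMeasurePreserving (hψ.invFun) (ν.map ψ) ν := by
    refine .of_aemeasurable hψ.measurable_invFun.aemeasurable ?_
    rw [Measure.map_map hψ.measurable_invFun hψ.measurable]
    rw [Function.LeftInverse.id hψ.leftInverse_invFun, Measure.map_id]
  have heval : NullMeasurePreserving (ShiftSpace.eval (1 : G)) (itineraryLaw G μ (ψ ∘ φ))
      (ν.map ψ) := by
    have hm : Measurable (ShiftSpace.eval (1 : G)) := (ShiftSpace.continuous_eval 1).measurable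
    refine .of_aemeasurable hm.aemeasurable ?_
    rw [itineraryLaw, AEMeasurable.map_map_of_aemeasurable hm.aemeasurable
      (aemeasurable_itinerary h.measurePreserving hθ),
      ← hφ.map.map_comp hψ.measurable.aemeasurable]
    congr 1
    funext x
    simp
  -- The inverse of the itinerary map reads the coordinate at the identity, undoes `ψ`, and returns
  -- from `Y` to `X`.
  have hg := hφ.inv.comp (hinv.comp heval)
  have hleft : ∀ᵐ x ∂μ, (φ' ∘ hψ.invFun ∘ ShiftSpace.eval (1 : G)) (Φ x) = x := by
    filter_upwards [hφ.left_inv] with x hx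
    simp [hΦdef, hψ.leftInverse_invFun (φ x), hx]
  refine ⟨Φ, _, ⟨hΦ, hg, hleft, ?_⟩, ⟨hΦ, fun g => .of_forall fun x => itinerary_smul _ _ _⟩⟩
  -- The right inverse identity holds at every point `Φ x` where the left one does; it descends to
  -- the law since equality of two almost everywhere measurable maps into the shift is a null
  -- measurable condition.
  refine hΦ.ae_iff ?_ (by filter_upwards [hleft] with x hx; rw [hx])
  exact nullMeasurableSet_eq_fun
    (hg.aemeasurable_comp (aemeasurable_itinerary h.measurePreserving hθ)) aemeasurable_id

end Model

/-! ### Convergence to one and diagonal sequences. -/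

section Convergence

theorem uniformFraction_le_one (d : ℕ) (s : Set (Fin d)) : uniformFraction d s ≤ 1 := by
  have h : s.ncard ≤ d := by simpa using Set.ncard_le_card s
  exact div_le_one_of_le₀ (by exact_mod_cast h) (by positivity)

theorem uniformFraction_mono {d : ℕ} {s t : Set (Fin d)} (h : s ⊆ t) :
    uniformFraction d s ≤ uniformFraction d t := by
  unfold uniformFraction
  gcongr
  exact Set.toFinite t

theorem tendsto_one_of_forall_lt {u : ℕ → ℝ} (hu : ∀ i, u i ≤ 1)
    (h : ∀ ε > 0, ∀ᶠ i in atTop, 1 - ε < u i) : Tendsto u atTop (𝓝 1) := by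
  rw [Metric.tendsto_nhds]
  intro ε hε
  filter_upwards [h ε hε] with i hi
  rw [Real.dist_eq, abs_lt]
  constructor <;> linarith [hu i]

theorem tendsto_one_of_forall_ofReal_lt {u : ℕ → ENNReal} (hu : ∀ i, u i ≤ 1)
    (h : ∀ ε > 0, ∀ᶠ i in atTop, ENNReal.ofReal (1 - ε) < u i) : Tendsto u atTop (𝓝 1) := by
  have hfin : ∀ i, u i ≠ ⊤ := fun i => ((hu i).trans_lt ENNReal.one_lt_top).ne
  rw [← ENNReal.tendsto_toReal_iff hfin ENNReal.one_ne_top]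
  refine tendsto_one_of_forall_lt (fun i => ?_) fun ε hε => ?_
  · simpa using ENNReal.toReal_mono ENNReal.one_ne_top (hu i)
  · filter_upwards [h ε hε] with i hi
    by_contra! hcon
    exact hi.not_ge ((ENNReal.ofReal_toReal (hfin i)).symm.le.trans (ENNReal.ofReal_le_ofReal hcon))

/-- If for every `n` the property `P n` holds eventually, then `P (k i) i` holds eventually for
some `k` tending to infinity. -/
theorem exists_tendsto_atTop_eventually_diagonal {P : ℕ → ℕ → Prop}
    (h : ∀ n, ∀ᶠ i in atTop, P n i) :
    ∃ k : ℕ → ℕ, Tendsto k atTop atTop ∧ ∀ᶠ i in atTop, P (k i) i := by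
  classical
  refine ⟨fun i => Nat.findGreatest (P · i) i, tendsto_atTop.2 fun n => ?_, ?_⟩
  · filter_upwards [h n, eventually_ge_atTop n] with i hi hn
    exact Nat.le_findGreatest hn hi
  -- `Nat.findGreatest` defaults to 0, so its value satisfies the property once `P 0 i` holds.
  · filter_upwards [h 0] with i hi
    exact Nat.findGreatest_spec (P := (P · i)) (Nat.zero_le i) hi

end Convergence

/-! ### Finitary form of local and empirical convergence. -/

section Approximation

variable {G : Type*} [Group G] {X : Type*} [TopologicalSpace X] [MeasurableSpace X] [MulAction G X]

/-- The finitary form of local and empirical convergence. -/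
structure IsEmpiricalApprox {d : ℕ} (τ : G → Equiv.Perm (Fin d)) (ρ : PseudoMetric X ℝ)
    (F : Finset G) (L : Finset C(X, ℝ)) (δ : ℝ) (M : Measure (Fin d → X)) (μ : Measure X) :
    Prop where
  local_close : ∀ f ∈ L,
    1 - δ < uniformFraction d {j | |(∫ x, f (x j) ∂M) - ∫ x, f x ∂μ| < δ}
  empirical : ENNReal.ofReal (1 - δ) < M (measMicrostates μ ρ F L δ τ)

theorem integrable_continuousMap [CompactSpace X] [OpensMeasurableSpace X] {W : Type*}
    [MeasurableSpace W] (M : Measure W) [IsFiniteMeasure M] (f : C(X, ℝ)) {u : W → X}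
    (hu : AEMeasurable u M) :
    Integrable (fun w => f (u w)) M :=
  Integrable.of_bound (f.continuous.measurable.comp_aemeasurable hu).aestronglyMeasurable ‖f‖
    (.of_forall fun _ => f.norm_coe_le_norm _)

/-- Replacing a test function by an `η`-close one costs `η` in the average and `η` in the limiting
integral. Allowing the measure to change as well serves both the passage from a dense sequence to
all functions and the closedness of approximability. -/
theorem IsEmpiricalApprox.mono [CompactSpace X] [OpensMeasurableSpace X] {d : ℕ}
    {τ : G → Equiv.Perm (Fin d)} {ρ : PseudoMetric X ℝ} {F F' : Finset G} {L L' : Finset C(X, ℝ)}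
    {δ δ' η : ℝ} {M : Measure (Fin d → X)} [IsProbabilityMeasure M] {μ μ' : Measure X}
    (h : IsEmpiricalApprox τ ρ F L δ M μ) (hF : F' ⊆ F) (hδ : δ + 2 * η ≤ δ') (hη : 0 ≤ η)
    (hL : ∀ f' ∈ L', ∃ f ∈ L, (∀ x, |f x - f' x| ≤ η) ∧ |∫ x, f x ∂μ - ∫ x, f' x ∂μ'| ≤ η) :
    IsEmpiricalApprox τ ρ F' L' δ' M μ' := by
  constructor
  · intro f' hf'
    obtain ⟨f, hf, h1, h2⟩ := hL f' hf'
    refine (by linarith : 1 - δ' ≤ 1 - δ).trans_lt ((h.local_close f hf).trans_le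
      (uniformFraction_mono fun j hj => ?_))
    have h3 : |∫ x, f (x j) ∂M - ∫ x, f' (x j) ∂M| ≤ η := by
      rw [← integral_sub (integrable_continuousMap M f (measurable_pi_apply j).aemeasurable)
        (integrable_continuousMap M f' (measurable_pi_apply j).aemeasurable)]
      have := norm_integral_le_of_norm_le_const (μ := M) (f := fun x => f (x j) - f' (x j)) (C := η)
        (.of_forall fun x => h1 (x j))
      simpa using this
    simp only [Set.mem_ofPred_eq, abs_lt, abs_le] at *
    constructor <;> linarith
  · refine (ENNReal.ofReal_le_ofReal (by linarith)).trans_lt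
      (h.empirical.trans_le (measure_mono fun φ hφ => ⟨fun g hg => ?_, fun f' hf' => ?_⟩))
    · exact (hφ.1 g (hF hg)).trans_le (by linarith)
    · obtain ⟨f, hf, h1, h2⟩ := hL f' hf'
      have h3 : |(∑ j, f (φ j)) / (d : ℝ) - (∑ j, f' (φ j)) / (d : ℝ)| ≤ η := by
        rw [← sub_div, ← Finset.sum_sub_distrib, abs_div, Nat.abs_cast]
        refine div_le_of_le_mul₀ (by positivity) hη ?_
        refine (Finset.abs_sum_le_sum_abs _ _).trans
          ((Finset.sum_le_sum fun j _ => h1 (φ j)).trans ?_)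
        simp [mul_comm]
      have h4 := hφ.2 f hf
      simp only [abs_lt, abs_le] at *
      constructor <;> linarith

theorem locallyEmpiricallyConverges_iff {d : ℕ → ℕ} (σ : ∀ i, G → Equiv.Perm (Fin (d i)))
    (μs : ∀ i, Measure (Fin (d i) → X)) [∀ i, IsProbabilityMeasure (μs i)] (μ : Measure X) :
    LocallyEmpiricallyConverges σ μs μ ↔ ∃ ρ : PseudoMetric X ℝ, IsDynGenerating G ρ ∧
      ∀ (F : Finset G) (L : Finset C(X, ℝ)) (δ : ℝ), 0 < δ →
        ∀ᶠ i in atTop, IsEmpiricalApprox (σ i) ρ F L δ (μs i) μ := by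
  refine exists_congr fun ρ => and_congr_right fun _ => ⟨fun ⟨h1, h2⟩ F L δ hδ => ?_,
    fun h => ⟨fun f κ hκ => ?_, fun F L δ hδ => ?_⟩⟩
  · have h3 : ∀ᶠ i in atTop, ∀ f ∈ L,
        1 - δ < uniformFraction (d i) {j | |(∫ x, f (x j) ∂(μs i)) - ∫ x, f x ∂μ| < δ} :=
      (Finset.eventually_all L).2 fun f _ =>
        (h1 f δ hδ).eventually_const_lt (by linarith)
    have h4 := (h2 F L δ hδ).eventually_const_lt (u := ENNReal.ofReal (1 - δ))
      (by rw [← ENNReal.ofReal_one, ENNReal.ofReal_lt_ofReal_iff one_pos]; linarith)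
    filter_upwards [h3, h4] with i h3 h4 using ⟨h3, h4⟩
  · refine tendsto_one_of_forall_lt (fun i => uniformFraction_le_one _ _) fun ε hε => ?_
    filter_upwards [h ∅ {f} (min ε κ) (lt_min hε hκ)] with i hi
    refine lt_of_le_of_lt (by linarith [min_le_left ε κ])
      ((hi.local_close f (by simp)).trans_le (uniformFraction_mono fun j hj => ?_))
    exact lt_of_lt_of_le hj (min_le_right ε κ)
  · refine tendsto_one_of_forall_ofReal_lt (fun i => prob_le_one) fun ε hε => ?_
    filter_upwards [h F L (min ε δ) (lt_min hε hδ)] with i hi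
    refine lt_of_le_of_lt (ENNReal.ofReal_le_ofReal (by linarith [min_le_left ε δ]))
      (hi.empirical.trans_le (measure_mono fun φ hφ => ⟨fun g hg => ?_, fun f hf => ?_⟩))
    · exact (hφ.1 g hg).trans_le (min_le_right ε δ)
    · exact (hφ.2 f hf).trans_le (min_le_right ε δ)

end Approximation

/-! ### Approximable laws on the shift. -/

section PairSpace

/-- A pair of labelings regarded as a labeling by pairs. -/
def pairLabel {X : Type*} {d : ℕ} (q : (Fin d → X) × (Fin d → X)) : Fin d → X × X :=
  fun j => (q.1 j, q.2 j)

@[fun_prop]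
theorem measurable_pairLabel {X : Type*} [MeasurableSpace X] {d : ℕ} :
    Measurable (pairLabel (X := X) (d := d)) := by
  unfold pairLabel
  fun_prop

instance {X : Type*} [MeasurableSpace X] {d : ℕ} (m : Measure (Fin d → X))
    [IsProbabilityMeasure m] : IsProbabilityMeasure ((m.prod m).map pairLabel) :=
  Measure.isProbabilityMeasure_map measurable_pairLabel.aemeasurable

variable (G : Type*) [Countable G] [Group G]

/-- The pseudometric on the square of the shift that compares the coordinates at the identity. -/
noncomputable def pairPseudoMetric : PseudoMetric (ShiftSpace G × ShiftSpace G) ℝ where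
  toFun w w' := dist (ShiftSpace.eval (1 : G) w.1, ShiftSpace.eval (1 : G) w.2)
    (ShiftSpace.eval (1 : G) w'.1, ShiftSpace.eval (1 : G) w'.2)
  refl' _ := dist_self _
  symm' _ _ := dist_comm _ _
  triangle' _ _ _ := dist_triangle _ _ _

theorem pairPseudoMetric_apply (w w' : ShiftSpace G × ShiftSpace G) :
    pairPseudoMetric G w w' = dist (ShiftSpace.eval (1 : G) w.1, ShiftSpace.eval (1 : G) w.2)
      (ShiftSpace.eval (1 : G) w'.1, ShiftSpace.eval (1 : G) w'.2) := rfl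

theorem continuous_pairPseudoMetric :
    Continuous fun q : (ShiftSpace G × ShiftSpace G) × (ShiftSpace G × ShiftSpace G) =>
      pairPseudoMetric G q.1 q.2 := by
  simp only [pairPseudoMetric_apply]
  have := ShiftSpace.continuous_eval (1 : G)
  fun_prop

/-- Translating by `g` before reading the identity coordinate reads coordinate `g`, so the
translates together separate points. -/
theorem isDynGenerating_pairPseudoMetric : IsDynGenerating G (pairPseudoMetric G) := by
  refine ⟨continuous_pairPseudoMetric G, fun x y hxy => ?_⟩
  by_contra! hcon
  refine hxy (Prod.ext (ShiftSpace.ext fun g => ?_) (ShiftSpace.ext fun g => ?_))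
  all_goals
    have := dist_le_zero.1 ((pairPseudoMetric_apply G _ _).symm.le.trans (hcon g))
    simp at this
    tauto

variable {G}

/-- A measure on the shift all of whose finitary statistics are, along the sofic approximation,
those of random labelings. -/
def IsApproximable {d : ℕ → ℕ} (σ : ∀ i, G → Equiv.Perm (Fin (d i))) (ν : Measure (ShiftSpace G)) :
    Prop :=
  ∀ (F : Finset G) (L : Finset C(ShiftSpace G × ShiftSpace G, ℝ)) (δ : ℝ), 0 < δ →
    ∀ᶠ i in atTop, ∃ m : Measure (Fin (d i) → ShiftSpace G), IsProbabilityMeasure m ∧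
      IsEmpiricalApprox (σ i) (pairPseudoMetric G) F L δ ((m.prod m).map pairLabel) (ν.prod ν)

variable {d : ℕ → ℕ} {σ : ∀ i, G → Equiv.Perm (Fin (d i))}

/-- Since `G` is countable and the continuous functions on the squared shift are separable,
countably many requirements imply all others; meet the first `k i` of them at index `i`, with `k`
tending to infinity. -/
theorem IsApproximable.exists_locallyDoublyEmpiricallyConverges {ν : Measure (ShiftSpace G)}
    [IsProbabilityMeasure ν] (h : IsApproximable σ ν) :
    ∃ νs : ∀ i, Measure (Fin (d i) → ShiftSpace G), (∀ i, IsProbabilityMeasure (νs i)) ∧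
      LocallyDoublyEmpiricallyConverges σ νs ν := by
  classical
  obtain ⟨e, he⟩ := exists_surjective_nat G
  let D := TopologicalSpace.denseSeq C(ShiftSpace G × ShiftSpace G, ℝ)
  obtain ⟨k, hk, hP⟩ := exists_tendsto_atTop_eventually_diagonal fun n =>
    h ((Finset.range n).image e) ((Finset.range n).image D) (1 / (n + 1)) (by positivity)
  have hex : ∀ i, ∃ m : Measure (Fin (d i) → ShiftSpace G), IsProbabilityMeasure m ∧
      ((∃ m : Measure (Fin (d i) → ShiftSpace G), IsProbabilityMeasure m ∧
        IsEmpiricalApprox (σ i) (pairPseudoMetric G) ((Finset.range (k i)).image e)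
          ((Finset.range (k i)).image D) (1 / (k i + 1)) ((m.prod m).map pairLabel) (ν.prod ν)) →
        IsEmpiricalApprox (σ i) (pairPseudoMetric G) ((Finset.range (k i)).image e)
          ((Finset.range (k i)).image D) (1 / (k i + 1)) ((m.prod m).map pairLabel)
          (ν.prod ν)) := fun i => by
    by_cases hi : ∃ m : Measure (Fin (d i) → ShiftSpace G), IsProbabilityMeasure m ∧
        IsEmpiricalApprox (σ i) (pairPseudoMetric G) ((Finset.range (k i)).image e)
          ((Finset.range (k i)).image D) (1 / (k i + 1)) ((m.prod m).map pairLabel) (ν.prod ν)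
    · obtain ⟨m, hm, hm'⟩ := hi
      exact ⟨m, hm, fun _ => hm'⟩
    -- A filler, used at only finitely many indices.
    · exact ⟨Measure.dirac fun _ => ShiftSpace.mk fun _ => 0, inferInstance, fun h => absurd h hi⟩
  choose νs hνs hgood using hex
  refine ⟨νs, hνs, (locallyEmpiricallyConverges_iff σ
    (fun i => ((νs i).prod (νs i)).map pairLabel) _).2 ⟨_, isDynGenerating_pairPseudoMetric G, fun F L δ hδ => ?_⟩⟩
  have hF : ∀ᶠ i in atTop, ∀ g ∈ F, g ∈ (Finset.range (k i)).image e :=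
    (Finset.eventually_all F).2 fun g _ => by
      obtain ⟨n, rfl⟩ := he g
      filter_upwards [hk.eventually_gt_atTop n] with i hi
      exact Finset.mem_image_of_mem _ (Finset.mem_range.2 hi)
  have hL : ∀ᶠ i in atTop, ∀ f' ∈ L, ∃ f ∈ (Finset.range (k i)).image D,
      (∀ x, |f x - f' x| ≤ δ / 4) ∧
        |∫ x, f x ∂(ν.prod ν) - ∫ x, f' x ∂(ν.prod ν)| ≤ δ / 4 :=
    (Finset.eventually_all L).2 fun f' _ => by
      obtain ⟨n, hn⟩ := (TopologicalSpace.denseRange_denseSeq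
        C(ShiftSpace G × ShiftSpace G, ℝ)).exists_dist_lt f' (show 0 < δ / 4 by positivity)
      have hpt : ∀ x, |D n x - f' x| ≤ δ / 4 := fun x => by
        have := (ContinuousMap.dist_apply_le_dist x).trans hn.le
        rwa [dist_comm] at this
      filter_upwards [hk.eventually_gt_atTop n] with i hi
      refine ⟨D n, Finset.mem_image_of_mem _ (Finset.mem_range.2 hi), hpt, ?_⟩
      rw [← integral_sub (integrable_continuousMap _ (D n) aemeasurable_id')
        (integrable_continuousMap _ f' aemeasurable_id')]
      simpa using norm_integral_le_of_norm_le_const (μ := ν.prod ν)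
        (f := fun x => D n x - f' x) (.of_forall hpt)
  have hδk : ∀ᶠ i in atTop, (1 : ℝ) / (k i + 1) < δ / 2 :=
    (tendsto_one_div_add_atTop_nhds_zero_nat.comp hk).eventually_lt_const (by positivity)
  filter_upwards [hP, hF, hL, hδk] with i hP hF hL hδk
  exact (hgood i hP).mono (η := δ / 4) hF (by linarith) (by positivity) hL

/-- The set of approximable measures is closed. -/
theorem IsApproximable.of_forall_close {ν : Measure (ShiftSpace G)}
    (h : ∀ (L : Finset C(ShiftSpace G × ShiftSpace G, ℝ)) (δ : ℝ), 0 < δ →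
      ∃ ν' : Measure (ShiftSpace G), IsApproximable σ ν' ∧
        ∀ f ∈ L, |∫ x, f x ∂(ν'.prod ν') - ∫ x, f x ∂(ν.prod ν)| ≤ δ) :
    IsApproximable σ ν := by
  intro F L δ hδ
  -- The tolerances add up as δ/2 + 2 · δ/4 = δ in `IsEmpiricalApprox.mono`.
  obtain ⟨ν', hν', hL⟩ := h L (δ / 4) (by positivity)
  filter_upwards [hν' F L (δ / 2) (by positivity)] with i ⟨m, hm, hi⟩
  refine ⟨m, hm, hi.mono (η := δ / 4) subset_rfl (by linarith) (by positivity) fun f hf => ?_⟩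
  exact ⟨f, hf, fun x => by simp; positivity, hL f hf⟩

end PairSpace

/-! ### Approximability under convergence in measure. -/

section LimitLaw

/-- With measurable representatives, all the integrals live on the fixed space `μ.prod μ`, where
dominated convergence applies with constant bound `‖f‖`. -/
theorem tendsto_integral_prod_map_of_ae_tendsto {X Z : Type*} [MeasurableSpace X]
    {μ : Measure X} [IsProbabilityMeasure μ] [TopologicalSpace Z] [CompactSpace Z]
    [MeasurableSpace Z] [OpensMeasurableSpace (Z × Z)] {Ψs : ℕ → X → Z} {Ψ : X → Z}
    (hs : ∀ n, AEMeasurable (Ψs n) μ) (hΨ : AEMeasurable Ψ μ)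
    (hlim : ∀ᵐ x ∂μ, Tendsto (fun n => Ψs n x) atTop (𝓝 (Ψ x))) (f : C(Z × Z, ℝ)) :
    Tendsto (fun n => ∫ w, f w ∂((μ.map (Ψs n)).prod (μ.map (Ψs n)))) atTop
      (𝓝 (∫ w, f w ∂((μ.map Ψ).prod (μ.map Ψ)))) := by
  have key : ∀ {Ψ : X → Z} (hΨ : AEMeasurable Ψ μ),
      ∫ w, f w ∂((μ.map Ψ).prod (μ.map Ψ))
        = ∫ q, f (hΨ.mk Ψ q.1, hΨ.mk Ψ q.2) ∂(μ.prod μ) := by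
    intro Ψ hΨ
    rw [Measure.map_congr hΨ.ae_eq_mk,
      Measure.map_prod_map _ _ hΨ.measurable_mk hΨ.measurable_mk,
      integral_map (hΨ.measurable_mk.prodMap hΨ.measurable_mk).aemeasurable
        f.continuous.measurable.aestronglyMeasurable]
    rfl
  simp only [key hΨ, key (hs _)]
  have hae : ∀ᵐ x ∂μ, Tendsto (fun n => (hs n).mk (Ψs n) x) atTop (𝓝 (hΨ.mk Ψ x)) := by
    filter_upwards [hlim, hΨ.ae_eq_mk, ae_all_iff.2 fun n => (hs n).ae_eq_mk] with x h1 h2 h3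
    simpa only [← h2, ← h3] using h1
  refine tendsto_integral_of_dominated_convergence (fun _ => ‖f‖) (fun n => ?_)
    (integrable_const _) (fun n => .of_forall fun q => f.norm_coe_le_norm _) ?_
  · exact (f.continuous.measurable.comp
      ((hs n).measurable_mk.prodMap (hs n).measurable_mk)).aestronglyMeasurable
  · filter_upwards [Measure.quasiMeasurePreserving_fst.ae hae,
      Measure.quasiMeasurePreserving_snd.ae hae] with q h1 h2
    exact (f.continuous.tendsto _).comp (h1.prodMk_nhds h2)

variable {G : Type*} [Countable G] [Group G] {d : ℕ → ℕ} {σ : ∀ i, G → Equiv.Perm (Fin (d i))}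
  {X : Type*} [MeasurableSpace X] [MulAction G X] {μ : Measure X}

/-- Convergence in measure gives almost everywhere convergence along a subsequence. By invariance
and countability of `G` this persists at all translates simultaneously, so the itineraries converge
almost everywhere and their laws converge against continuous test functions. -/
theorem isApproximable_itineraryLaw_of_forall_close [IsProbabilityMeasure μ]
    (hμ : ∀ g : G, NullMeasurePreserving (fun x : X => g • x) μ μ)
    {θ : X → unitInterval} (hθ : AEMeasurable θ μ)
    (h : ∀ ε : ℝ, 0 < ε → ∃ θ' : X → unitInterval, AEMeasurable θ' μ ∧
      IsApproximable σ (itineraryLaw G μ θ') ∧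
        μ {x | ε ≤ dist (θ' x) (θ x)} ≤ ENNReal.ofReal ε) :
    IsApproximable σ (itineraryLaw G μ θ) := by
  choose θs hmeas happ hclose using fun n : ℕ => h (1 / (n + 1)) (by positivity)
  have hT : TendstoInMeasure μ θs atTop θ := by
    rw [tendstoInMeasure_iff_dist]
    intro ε hε
    have hlim : Tendsto (fun n : ℕ => ENNReal.ofReal (1 / ((n : ℝ) + 1))) atTop (𝓝 0) := by
      simpa using ENNReal.tendsto_ofReal tendsto_one_div_add_atTop_nhds_zero_nat
    refine tendsto_of_tendsto_of_tendsto_of_le_of_le' tendsto_const_nhds hlim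
      (.of_forall fun _ => zero_le) ?_
    filter_upwards [tendsto_one_div_add_atTop_nhds_zero_nat.eventually_lt_const hε] with n hn
    exact (measure_mono fun x hx => hn.le.trans hx).trans (hclose n)
  obtain ⟨ns, -, hns⟩ := hT.exists_seq_tendsto_ae
  refine .of_forall_close fun L δ hδ => ?_
  have hev : ∀ᶠ n in atTop, ∀ f ∈ L,
      |∫ x, f x ∂((itineraryLaw G μ (θs (ns n))).prod (itineraryLaw G μ (θs (ns n))))
        - ∫ x, f x ∂((itineraryLaw G μ θ).prod (itineraryLaw G μ θ))| ≤ δ :=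
    (Finset.eventually_all L).2 fun f _ => by
      have := tendsto_integral_prod_map_of_ae_tendsto
        (fun n => aemeasurable_itinerary hμ (hmeas (ns n))) (aemeasurable_itinerary hμ hθ)
        (by
          filter_upwards [ae_all_iff.2 fun g => (hμ g).ae hns] with x hx
          exact ShiftSpace.tendsto_of_eval fun g => by simpa using hx g) f
      filter_upwards [Metric.tendsto_nhds.1 this δ hδ] with n hn
      exact hn.le
  obtain ⟨n, hn⟩ := hev.exists
  exact ⟨_, happ (ns n), hn⟩

end LimitLaw

/-! ### Mean-square equivariance defects of translates. -/

section MeanSquare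

/-- Use the triangle inequality through `φ (τ (h * g) j)`, then (a+b)² ≤ 2a² + 2b². Where `τ` is
multiplicative the second leg is the defect of `h` at `τ g j`, which reindexing by the permutation
turns into the plain defect; elsewhere it is bounded by `B`. -/
theorem mean_sq_translate_le {G : Type*} [Group G] {W : Type*} [MulAction G W]
    {ρ : PseudoMetric W ℝ} {B : ℝ} (hB : ∀ x y, ρ x y ^ 2 ≤ B) {d : ℕ} (hd : 0 < d)
    (τ : G → Equiv.Perm (Fin d)) (g h : G) (φ : Fin d → W) :
    (∑ j, ρ (h • g • φ j) (h • φ (τ g j)) ^ 2) / d ≤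
      2 * ((∑ j, ρ ((h * g) • φ j) (φ (τ (h * g) j)) ^ 2) / d) +
      2 * ((∑ j, ρ (h • φ j) (φ (τ h j)) ^ 2) / d) +
      2 * B * (1 - uniformFraction d {j | τ h (τ g j) = τ (h * g) j}) := by
  classical
  have hpt : ∀ j, ρ (h • g • φ j) (h • φ (τ g j)) ^ 2 ≤
      2 * ρ ((h * g) • φ j) (φ (τ (h * g) j)) ^ 2 +
      2 * ρ (h • φ (τ g j)) (φ (τ h (τ g j))) ^ 2 +
      2 * B * (1 - if τ h (τ g j) = τ (h * g) j then 1 else 0) := fun j => by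
    have h1 := ρ.triangle ((h * g) • φ j) (φ (τ (h * g) j)) (h • φ (τ g j))
    have h0 := ρ.nonneg ((h * g) • φ j) (h • φ (τ g j))
    have h2 : ρ (φ (τ (h * g) j)) (h • φ (τ g j)) ^ 2 ≤
        ρ (h • φ (τ g j)) (φ (τ h (τ g j))) ^ 2 +
          B * (1 - if τ h (τ g j) = τ (h * g) j then 1 else 0) := by
      split_ifs with hj
      · rw [hj, ρ.symm]; simp
      · have := hB (φ (τ (h * g) j)) (h • φ (τ g j))
        have := sq_nonneg (ρ (h • φ (τ g j)) (φ (τ h (τ g j))))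
        linarith
    rw [← mul_smul]
    nlinarith [sq_nonneg (ρ ((h * g) • φ j) (φ (τ (h * g) j)) -
      ρ (φ (τ (h * g) j)) (h • φ (τ g j)))]
  have hfrac : uniformFraction d {j | τ h (τ g j) = τ (h * g) j} =
      (∑ j, if τ h (τ g j) = τ (h * g) j then (1 : ℝ) else 0) / d := by
    rw [uniformFraction, Finset.sum_boole, Set.ncard_eq_toFinset_card']
    simp
  have hperm : ∑ j, ρ (h • φ (τ g j)) (φ (τ h (τ g j))) ^ 2 =
      ∑ j, ρ (h • φ j) (φ (τ h j)) ^ 2 :=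
    Equiv.sum_comp (τ g) fun j => ρ (h • φ j) (φ (τ h j)) ^ 2
  have hd' : (0 : ℝ) < d := by exact_mod_cast hd
  have hs := Finset.sum_le_sum fun j (_ : j ∈ Finset.univ) => hpt j
  rw [Finset.sum_add_distrib, Finset.sum_add_distrib, ← Finset.mul_sum, ← Finset.mul_sum,
    ← Finset.mul_sum, hperm, Finset.sum_sub_distrib] at hs
  simp only [Finset.sum_const, Finset.card_univ, Fintype.card_fin, nsmul_eq_mul, mul_one] at hs
  rw [hfrac, div_le_iff₀ hd']
  refine hs.trans (le_of_eq ?_)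
  field_simp

theorem rhoTwo_lt_iff {X : Type*} (ρ : PseudoMetric X ℝ) {d : ℕ} (x y : Fin d → X) {δ : ℝ}
    (hδ : 0 < δ) : rhoTwo ρ x y < δ ↔ (∑ j, ρ (x j) (y j) ^ 2) / (d : ℝ) < δ ^ 2 :=
  Real.sqrt_lt' hδ

end MeanSquare

/-! ### Comparison of continuous pseudometrics. -/

section Generating

variable {G : Type*} [Group G] {W : Type*} [TopologicalSpace W] [CompactSpace W] [MulAction G W]
  [ContinuousConstSMul G W] {ρ ρ' : PseudoMetric W ℝ}

theorem PseudoMetric.exists_sq_le (hρ : Continuous fun q : W × W => ρ q.1 q.2) :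
    ∃ B : ℝ, 0 ≤ B ∧ ∀ x y, ρ x y ^ 2 ≤ B := by
  obtain ⟨B, hB⟩ := isCompact_univ.exists_bound_of_continuousOn (hρ.pow 2).continuousOn
  refine ⟨max B 0, le_max_right _ _, fun x y => le_max_of_le_left ?_⟩
  simpa using hB (x, y) trivial

/-- A continuous pseudometric is controlled by finitely many translates of a dynamically generating
one. -/
theorem IsDynGenerating.exists_sq_le_sum (hρ : IsDynGenerating G ρ)
    (hρ' : Continuous fun q : W × W => ρ' q.1 q.2) {ε : ℝ} (hε : 0 < ε) :
    ∃ (F : Finset G) (C : ℝ), 0 ≤ C ∧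
      ∀ x y, ρ' x y ^ 2 ≤ ε + C * ∑ h ∈ F, ρ (h • x) (h • y) ^ 2 := by
  have hcont : ∀ h : G, Continuous fun q : W × W => ρ (h • q.1) (h • q.2) := fun h =>
    hρ.continuous.comp (by fun_prop : Continuous fun q : W × W => (h • q.1, h • q.2))
  -- This compact set misses the diagonal, so finitely many translates of `ρ` suffice to be nonzero
  -- on it. Their sum of squares has a positive minimum `c` there, and `B / c` is the required
  -- constant.
  have hK : IsCompact {q : W × W | ε ≤ ρ' q.1 q.2 ^ 2} :=
    (isClosed_le continuous_const (hρ'.pow 2)).isCompact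
  obtain ⟨F, hF⟩ := hK.elim_finite_subcover (fun h : G => {q : W × W | 0 < ρ (h • q.1) (h • q.2)})
    (fun h => isOpen_lt continuous_const (hcont h)) fun q hq => by
      have hne : q.1 ≠ q.2 := fun heq => by
        have : ε ≤ ρ' q.1 q.2 ^ 2 := hq
        rw [heq, ρ'.refl] at this
        norm_num at this
        linarith
      simpa using hρ.generating _ _ hne
  have hsum : ∀ x y : W, 0 ≤ ∑ h ∈ F, ρ (h • x) (h • y) ^ 2 := fun x y =>
    Finset.sum_nonneg fun _ _ => sq_nonneg _
  rcases Set.eq_empty_or_nonempty {q : W × W | ε ≤ ρ' q.1 q.2 ^ 2} with hemp | hne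
  · refine ⟨F, 0, le_rfl, fun x y => ?_⟩
    by_contra! hcon
    have : (x, y) ∈ {q : W × W | ε ≤ ρ' q.1 q.2 ^ 2} := by
      change ε ≤ ρ' x y ^ 2
      linarith
    simp [hemp] at this
  obtain ⟨q₀, hq₀, hmin⟩ := hK.exists_isMinOn hne
    (continuous_finsetSum F fun h _ => (hcont h).pow 2).continuousOn
  have hpos : 0 < ∑ h ∈ F, ρ (h • q₀.1) (h • q₀.2) ^ 2 := by
    obtain ⟨h, hh, hh'⟩ := Set.mem_iUnion₂.1 (hF hq₀)
    have hlt : 0 < ρ (h • q₀.1) (h • q₀.2) := hh'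
    exact Finset.sum_pos' (fun _ _ => sq_nonneg _) ⟨h, hh, by positivity⟩
  obtain ⟨B, hB0, hB⟩ := PseudoMetric.exists_sq_le hρ'
  set c := ∑ h ∈ F, ρ (h • q₀.1) (h • q₀.2) ^ 2
  refine ⟨F, B / c, by positivity, fun x y => ?_⟩
  by_cases hxy : ε ≤ ρ' x y ^ 2
  · have h1 : c ≤ ∑ h ∈ F, ρ (h • x) (h • y) ^ 2 := hmin (a := (x, y)) hxy
    calc ρ' x y ^ 2 ≤ B / c * c := by rw [div_mul_cancel₀ _ hpos.ne']; exact hB x y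
      _ ≤ B / c * ∑ h ∈ F, ρ (h • x) (h • y) ^ 2 := by gcongr
      _ ≤ _ := by linarith
  · have := mul_nonneg (div_nonneg hB0 hpos.le) (hsum x y)
    linarith

/-- Approximate equivariance with respect to a dynamically generating pseudometric implies
approximate equivariance with respect to every continuous pseudometric. -/
theorem IsDynGenerating.eventually_rhoTwo_lt {d : ℕ → ℕ} {σ : ∀ i, G → Equiv.Perm (Fin (d i))}
    (hσ : IsSoficApproximation σ) (hρ : IsDynGenerating G ρ)
    (hρ' : Continuous fun q : W × W => ρ' q.1 q.2) (F : Finset G) {ε : ℝ} (hε : 0 < ε) :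
    ∃ (F' : Finset G) (δ : ℝ), 0 < δ ∧ ∀ᶠ i in atTop, ∀ φ : Fin (d i) → W,
      (∀ h ∈ F', rhoTwo ρ (fun j => h • φ j) (fun j => φ (σ i h j)) < δ) →
      ∀ g ∈ F, rhoTwo ρ' (fun j => g • φ j) (fun j => φ (σ i g j)) < ε := by
  classical
  obtain ⟨F₀, C, hC, hF₀⟩ := hρ.exists_sq_le_sum hρ' (ε := ε ^ 2 / 2) (by positivity)
  obtain ⟨B, hB0, hB⟩ := PseudoMetric.exists_sq_le hρ.continuous
  -- With these choices the two error terms are at most ε²/4 and ε²/8, on top of ε²/2. The added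
  -- ones keep denominators positive.
  set D : ℝ := C * F₀.card + 1 with hD
  have hD1 : 1 ≤ D := by rw [hD]; linarith [show 0 ≤ C * F₀.card by positivity]
  set δ := ε / (4 * D) with hδ
  have hδ0 : 0 < δ := by positivity
  set η := ε ^ 2 / (16 * D * (B + 1)) with hη
  have hη0 : 0 < η := by positivity
  -- Comparing `h • g • φ j` with `h • φ (σ i g j)` uses the defects of both `h` and `h * g`.
  refine ⟨F₀ ∪ F₀ * F, δ, hδ0, ?_⟩
  have hev : ∀ᶠ i in atTop, ∀ h ∈ F₀, ∀ g ∈ F,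
      1 - η < uniformFraction (d i) {j | σ i h (σ i g j) = σ i (h * g) j} :=
    (Finset.eventually_all F₀).2 fun h _ => (Finset.eventually_all F).2 fun g _ =>
      (hσ.mul h g).eventually_const_lt (by linarith)
  filter_upwards [hev] with i hi φ hφ g hg
  have hd : (0 : ℝ) < d i := by exact_mod_cast hσ.pos i
  rw [rhoTwo_lt_iff _ _ _ hε]
  have hterm : ∀ h ∈ F₀, (∑ j, ρ (h • g • φ j) (h • φ (σ i g j)) ^ 2) / (d i : ℝ) ≤
      4 * δ ^ 2 + 2 * B * η := fun h hh => by
    refine (mean_sq_translate_le hB (hσ.pos i) (σ i) g h φ).trans ?_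
    have h1 := (rhoTwo_lt_iff _ _ _ hδ0).1
      (hφ (h * g) (Finset.mem_union_right _ (Finset.mul_mem_mul hh hg)))
    have h2 := (rhoTwo_lt_iff _ _ _ hδ0).1 (hφ h (Finset.mem_union_left _ hh))
    have h3 : 2 * B * (1 - uniformFraction (d i) {j | σ i h (σ i g j) = σ i (h * g) j}) ≤
        2 * B * η := by
      gcongr
      linarith [hi h hh g hg]
    linarith
  have hD' : C * F₀.card ≤ D := by rw [hD]; linarith
  calc (∑ j, ρ' (g • φ j) (φ (σ i g j)) ^ 2) / (d i : ℝ)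
      ≤ (∑ j, (ε ^ 2 / 2 + C * ∑ h ∈ F₀, ρ (h • g • φ j) (h • φ (σ i g j)) ^ 2)) / (d i : ℝ) := by
        gcongr with j
        exact hF₀ _ _
    _ = ε ^ 2 / 2 + C * ∑ h ∈ F₀, (∑ j, ρ (h • g • φ j) (h • φ (σ i g j)) ^ 2) / (d i : ℝ) := by
        rw [Finset.sum_add_distrib, ← Finset.mul_sum, Finset.sum_comm]
        simp only [← Finset.sum_div, Finset.sum_const, Finset.card_univ, Fintype.card_fin, nsmul_eq_mul]
        field_simp
    _ ≤ ε ^ 2 / 2 + C * ∑ h ∈ F₀, (4 * δ ^ 2 + 2 * B * η) := by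
        gcongr with h hh
        exact hterm h hh
    _ = ε ^ 2 / 2 + C * F₀.card * (4 * δ ^ 2 + 2 * B * η) := by simp; ring
    _ ≤ ε ^ 2 / 2 + D * (4 * δ ^ 2 + 2 * B * η) := by gcongr
    _ = ε ^ 2 / 2 + (ε ^ 2 / 4 / D + ε ^ 2 / 8 * (B / (B + 1))) := by
        rw [hδ, hη]; field_simp; ring
    _ ≤ ε ^ 2 / 2 + (ε ^ 2 / 4 + ε ^ 2 / 8 * 1) := by
        have h1 : ε ^ 2 / 4 / D ≤ ε ^ 2 / 4 := div_le_self (by positivity) hD1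
        have h2 : B / (B + 1) ≤ 1 := div_le_one_of_le₀ (by linarith) (by linarith)
        gcongr
    _ < ε ^ 2 := by nlinarith [pow_pos hε 2]

end Generating

/-! ### Strong soficity and approximability of itinerary laws. -/

section Pushforward

theorem IsEmpiricalApprox.map {G : Type*} [Group G] {W W' : Type*} [TopologicalSpace W]
    [TopologicalSpace W'] [MeasurableSpace W] [MeasurableSpace W'] [OpensMeasurableSpace W']
    [CompactSpace W'] [MulAction G W] [MulAction G W'] {d : ℕ} {τ : G → Equiv.Perm (Fin d)}
    {ρ : PseudoMetric W ℝ} {ρ' : PseudoMetric W' ℝ} {F F' : Finset G} {L : Finset C(W, ℝ)}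
    {L' : Finset C(W', ℝ)} {δ δ' : ℝ} {M : Measure (Fin d → W)} {μ : Measure W}
    (h : IsEmpiricalApprox τ ρ F L δ M μ) (Ψ : C(W, W')) (hΨ : Measurable Ψ) (hδ : δ ≤ δ')
    (hL : ∀ f ∈ L', f.comp Ψ ∈ L)
    (hF : ∀ φ : Fin d → W, (∀ g ∈ F, rhoTwo ρ (fun j => g • φ j) (fun j => φ (τ g j)) < δ) →
      ∀ g ∈ F', rhoTwo ρ' (fun j => g • Ψ (φ j)) (fun j => Ψ (φ (τ g j))) < δ') :
    IsEmpiricalApprox τ ρ' F' L' δ' (M.map fun φ j => Ψ (φ j)) (μ.map Ψ) := by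
  have hm : Measurable fun (φ : Fin d → W) j => Ψ (φ j) := by fun_prop
  have hint : ∀ f : C(W', ℝ), ∫ x, f x ∂(μ.map Ψ) = ∫ x, f.comp Ψ x ∂μ := fun f =>
    integral_map hΨ.aemeasurable f.continuous.measurable.aestronglyMeasurable
  constructor
  · intro f hf
    refine (by linarith : 1 - δ' ≤ 1 - δ).trans_lt
      ((h.local_close _ (hL f hf)).trans_le (uniformFraction_mono fun j hj => ?_))
    have hj' : |(∫ x, f.comp Ψ (x j) ∂M) - ∫ x, f.comp Ψ x ∂μ| < δ := hj
    change |(∫ x, f (x j) ∂(M.map fun φ j => Ψ (φ j))) - ∫ x, f x ∂(μ.map Ψ)| < δ'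
    have hfj : Measurable fun x : Fin d → W' => f (x j) :=
      f.continuous.measurable.comp (measurable_pi_apply j)
    rw [hint, integral_map hm.aemeasurable hfj.aestronglyMeasurable]
    exact hj'.trans_le hδ
  -- `Measure.le_map_apply` holds for arbitrary sets, so the microstate set need not be shown
  -- measurable.
  · refine (ENNReal.ofReal_le_ofReal (by linarith)).trans_lt
      (h.empirical.trans_le ((measure_mono fun φ hφ => ?_).trans
        (Measure.le_map_apply hm.aemeasurable _)))
    refine ⟨hF φ hφ.1, fun f hf => ?_⟩
    rw [hint]
    exact (hφ.2 _ (hL f hf)).trans_le hδ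

variable {G : Type*} [Countable G] [Group G] {d : ℕ → ℕ} {σ : ∀ i, G → Equiv.Perm (Fin (d i))}

/-- The itinerary of a continuous function is continuous and equivariant. It pulls the pseudometric
on pairs back to a continuous one on `Z × Z`, controlled by the generating one, so the
pushed-forward measures satisfy the requirements. -/
theorem LocallyDoublyEmpiricallyConverges.isApproximable_of_continuous
    (hσ : IsSoficApproximation σ) {Z : Type*} [TopologicalSpace Z] [CompactSpace Z]
    [SecondCountableTopology Z] [MeasurableSpace Z] [BorelSpace Z] [MulAction G Z]
    [ContinuousConstSMul G Z] {ν : Measure Z} [IsProbabilityMeasure ν]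
    {νs : ∀ i, Measure (Fin (d i) → Z)} [∀ i, IsProbabilityMeasure (νs i)]
    (h : LocallyDoublyEmpiricallyConverges σ νs ν) {θ : Z → unitInterval} (hθ : Continuous θ) :
    IsApproximable σ (itineraryLaw G ν θ) := by
  classical
  have hΦ : Continuous (itinerary G θ) := ShiftSpace.continuous_of_eval fun g => by
    simpa [Function.comp_def] using hθ.comp (continuous_const_smul g)
  obtain ⟨ρ, hρ, hgood⟩ := (locallyEmpiricallyConverges_iff σ
    (fun i => ((νs i).prod (νs i)).map pairLabel) _).1 h
  let Ψ : C(Z × Z, ShiftSpace G × ShiftSpace G) :=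
    ⟨Prod.map (itinerary G θ) (itinerary G θ), hΦ.prodMap hΦ⟩
  let ρ' : PseudoMetric (Z × Z) ℝ :=
    { toFun := fun x y => pairPseudoMetric G (Ψ x) (Ψ y)
      refl' := fun x => (pairPseudoMetric G).refl _
      symm' := fun x y => (pairPseudoMetric G).symm _ _
      triangle' := fun x y z => (pairPseudoMetric G).triangle _ _ _ }
  have hρ' : Continuous fun q : (Z × Z) × (Z × Z) => ρ' q.1 q.2 :=
    (continuous_pairPseudoMetric G).comp
      (by fun_prop : Continuous fun q : (Z × Z) × (Z × Z) => (Ψ q.1, Ψ q.2))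
  intro F L δ hδ
  obtain ⟨F', δ', hδ', hev⟩ := hρ.eventually_rhoTwo_lt hσ hρ' F hδ
  filter_upwards [hev, hgood F' (L.image fun f => f.comp Ψ) (min δ δ') (lt_min hδ hδ')] with i hi hi'
  have hm : Measurable fun (φ : Fin (d i) → Z) j => itinerary G θ (φ j) := by
    have := hΦ.measurable
    fun_prop
  refine ⟨(νs i).map fun φ j => itinerary G θ (φ j),
    Measure.isProbabilityMeasure_map hm.aemeasurable, ?_⟩
  have hmap := hi'.map (ρ' := pairPseudoMetric G) (F' := F) (L' := L) (δ' := δ) Ψ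
    (hΦ.measurable.prodMap hΦ.measurable) (min_le_left _ _)
    (fun f hf => Finset.mem_image_of_mem _ hf) fun φ hφ g hg => ?_
  · convert hmap using 1
    · rw [Measure.map_prod_map _ _ hm hm, Measure.map_map measurable_pairLabel (hm.prodMap hm),
        Measure.map_map (by have := (hΦ.measurable.prodMap hΦ.measurable); fun_prop)
          measurable_pairLabel]
      rfl
    · exact Measure.map_prod_map _ _ hΦ.measurable hΦ.measurable
  · have := hi φ (fun h hh => (hφ h hh).trans_le (min_le_right _ _)) g hg
    refine lt_of_eq_of_lt ?_ this
    unfold rhoTwo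
    congr 2
    refine Finset.sum_congr rfl fun j _ => ?_
    have heq : g • Ψ (φ j) = Ψ (g • φ j) :=
      Prod.ext (itinerary_smul _ _ _).symm (itinerary_smul _ _ _).symm
    change pairPseudoMetric G (g • Ψ (φ j)) _ ^ 2 = _
    rw [heq]
    rfl

/-- Bounded continuous functions are dense in L¹, so the Markov inequality gives closeness in
measure; clamping to the unit interval does not increase distances to `θ`. -/
theorem exists_continuous_measure_dist_ge_le {Z : Type*} [TopologicalSpace Z] [NormalSpace Z]
    [MeasurableSpace Z] [BorelSpace Z] {ν : Measure Z} [IsFiniteMeasure ν] [ν.WeaklyRegular]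
    {θ : Z → unitInterval} (hθ : AEMeasurable θ ν) {ε : ℝ} (hε : 0 < ε) :
    ∃ θ' : Z → unitInterval, Continuous θ' ∧ ν {x | ε ≤ dist (θ' x) (θ x)} ≤ ENNReal.ofReal ε := by
  have hint : Integrable (fun z => (θ z : ℝ)) ν :=
    Integrable.of_bound (measurable_subtype_coe.comp_aemeasurable hθ).aestronglyMeasurable 1
      (.of_forall fun z => by
        rw [Real.norm_of_nonneg (θ z).2.1]; exact (θ z).2.2)
  obtain ⟨u, hu, hui⟩ := hint.exists_boundedContinuous_integral_sub_le (ε := ε * ε) (by positivity)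
  refine ⟨fun z => Set.projIcc 0 1 zero_le_one (u z), by fun_prop, ?_⟩
  have hM := mul_meas_ge_le_integral_of_nonneg (.of_forall fun z => norm_nonneg ((θ z : ℝ) - u z))
    (hint.sub hui).norm ε
  have hle : ν.real {z | ε ≤ ‖(θ z : ℝ) - u z‖} ≤ ε :=
    le_of_mul_le_mul_left (hM.trans hu) hε
  refine (measure_mono fun z hz => ?_).trans
    (ENNReal.le_ofReal_iff_toReal_le (measure_ne_top _ _) hε.le |>.2 hle)
  have hz' : ε ≤ dist (Set.projIcc 0 1 zero_le_one (u z)) (θ z) := hz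
  refine hz'.trans ?_
  have := Set.abs_projIcc_sub_projIcc (zero_le_one' ℝ) (c := u z) (d := θ z)
  rw [Set.projIcc_val] at this
  rw [Subtype.dist_eq, Real.dist_eq, Real.norm_eq_abs, abs_sub_comm (θ z : ℝ)]
  exact this

theorem SMulInvariantMeasure.nullMeasurePreserving {G : Type*} [Group G] {Z : Type*} [MeasurableSpace Z] [MulAction G Z]
    [MeasurableConstSMul G Z] (ν : Measure Z) [SMulInvariantMeasure G Z ν] (g : G) :
    NullMeasurePreserving (fun z : Z => g • z) ν ν :=
  .of_aemeasurable (measurable_const_smul g).aemeasurable (measurePreserving_smul g ν).map_eq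

/-- Laws of itineraries in a strongly sofic action are approximable. -/
theorem IsStronglySofic.isApproximable (hσ : IsSoficApproximation σ) {X : Type*}
    [MeasurableSpace X] [MulAction G X] {μ : Measure X}
    (hμ : ∀ g : G, NullMeasurePreserving (fun x : X => g • x) μ μ) (h : IsStronglySofic σ μ)
    {θ : X → unitInterval} (hθ : AEMeasurable θ μ) : IsApproximable σ (itineraryLaw G μ θ) := by
  obtain ⟨Z, _, _, _, _, _, _, _, ν, _, _, ⟨f, g, hfg, hf⟩, νs, _, hνs⟩ := h
  let := TopologicalSpace.metrizableSpaceMetric Z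
  have hν := SMulInvariantMeasure.nullMeasurePreserving (G := G) ν
  have hθg : AEMeasurable (θ ∘ g) ν := hfg.inv.aemeasurable_comp hθ
  have hlaw : itineraryLaw G μ θ = itineraryLaw G ν (θ ∘ g) := by
    rw [← itineraryLaw_comp hν hf hθg]
    refine itineraryLaw_congr hμ ?_
    filter_upwards [hfg.left_inv] with x hx
    simp [hx]
  rw [hlaw]
  refine isApproximable_itineraryLaw_of_forall_close hν hθg fun ε hε => ?_
  obtain ⟨θ', hc, hle⟩ := exists_continuous_measure_dist_ge_le hθg hε
  exact ⟨θ', hc.measurable.aemeasurable, hνs.isApproximable_of_continuous hσ hc, hle⟩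

/-- An action all of whose itinerary laws are approximable is strongly sofic. -/
theorem IsPMPAction.isStronglySofic_of_isApproximable {X : Type*}
    [MeasurableSpace X] [MulAction G X] {μ : Measure X} (hμ : IsPMPAction G μ)
    (h : ∀ θ : X → unitInterval, AEMeasurable θ μ → IsApproximable σ (itineraryLaw G μ θ)) :
    IsStronglySofic σ μ := by
  obtain ⟨θ, hθ, hiso⟩ := hμ.exists_actionsIsomorphic_itineraryLaw
  have := hμ.standard.1
  have hprob := (nullMeasurePreserving_itinerary hμ.measurePreserving hθ).isProbabilityMeasure
  exact ⟨ShiftSpace G, inferInstance, inferInstance, inferInstance, inferInstance, inferInstance,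
    inferInstance, inferInstance, itineraryLaw G μ θ, hprob,
    smulInvariant_itineraryLaw hμ.measurePreserving hθ, hiso,
    (h θ hθ).exists_locallyDoublyEmpiricallyConverges⟩

end Pushforward

/-! ### Finite labelings and discretization. -/

section Labels

/-- The label of the member of a family of sets that contains a given point. -/
noncomputable def familyLabel {K X : Type*} [Nonempty K] (B : K → Set X) (x : X) : K :=
  Classical.epsilon fun k => x ∈ B k

theorem familyLabel_eq {K X : Type*} [Nonempty K] {B : K → Set X} {x : X} {k : K} (hk : x ∈ B k)
    (huniq : ∀ l, l ≠ k → x ∉ B l) : familyLabel B x = k := by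
  by_contra hne
  exact huniq _ hne (Classical.epsilon_spec (p := fun k => x ∈ B k) ⟨k, hk⟩)

/-- The label depends only on the vector of memberships, which takes values in a finite discrete
space. -/
theorem aemeasurable_familyLabel {K X : Type*} [Nonempty K] [Finite K] [MeasurableSpace K]
    [MeasurableSingletonClass K] [MeasurableSpace X] {μ : Measure X} {B : K → Set X}
    (hB : ∀ k, NullMeasurableSet (B k) μ) : AEMeasurable (familyLabel B) μ := by
  have h1 : AEMeasurable (fun x k => x ∈ B k) μ := by
    refine aemeasurable_pi_lambda _ fun k => ?_
    have h : Measurable fun x : NullMeasurableSpace X μ => x ∈ B k := measurable_mem.2 (hB k)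
    exact NullMeasurable.aemeasurable fun s hs => h hs
  exact (Measurable.of_discrete (f := fun P : K → Prop => Classical.epsilon P)).comp_aemeasurable h1

/-- The unit interval can be measurably discretized at every scale. -/
theorem unitInterval.exists_measurable_discretization {ε : ℝ} (hε : 0 < ε) :
    ∃ (r : ℕ) (u : unitInterval → Fin (r + 1)) (v : Fin (r + 1) → unitInterval),
      Measurable u ∧ ∀ t, dist (v (u t)) t < ε := by
  obtain ⟨n, hn⟩ := exists_nat_one_div_lt hε
  have hn0 : (0 : ℝ) < n + 1 := by positivity
  have hfl : ∀ t : unitInterval, (⌊((n : ℝ) + 1) * t⌋₊ : ℝ) ≤ (n + 1) * t := fun t =>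
    Nat.floor_le (mul_nonneg hn0.le t.2.1)
  have hlt : ∀ t : unitInterval, ⌊((n : ℝ) + 1) * t⌋₊ < n + 1 + 1 := fun t => by
    have : (⌊((n : ℝ) + 1) * t⌋₊ : ℝ) ≤ n + 1 :=
      (hfl t).trans (mul_le_of_le_one_right hn0.le t.2.2)
    have : ⌊((n : ℝ) + 1) * t⌋₊ ≤ n + 1 := by exact_mod_cast this
    omega
  -- The floor attains `n + 1` at `t = 1`, hence `n + 2` labels.
  refine ⟨n + 1, fun t => ⟨⌊((n : ℝ) + 1) * t⌋₊, hlt t⟩,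
    fun k => ⟨(k : ℝ) / (n + 1), by positivity, ?_⟩, ?_, fun t => ?_⟩
  · rw [div_le_one hn0]
    have := k.2
    have : (k : ℕ) ≤ n + 1 := by omega
    exact_mod_cast this
  · refine measurable_to_countable' fun k => ?_
    have : Measurable fun t : unitInterval => ⌊((n : ℝ) + 1) * t⌋₊ := by fun_prop
    convert this (measurableSet_singleton (k : ℕ)) using 1
    ext t
    simp [Fin.ext_iff]
  · rw [Subtype.dist_eq, Real.dist_eq, abs_lt]
    have h1 := hfl t
    have h2 := Nat.lt_floor_add_one (((n : ℝ) + 1) * t)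
    have h3 : (⌊((n : ℝ) + 1) * t⌋₊ : ℝ) / (n + 1) ≤ t := by
      rw [div_le_iff₀ hn0]; linarith
    have h4 : (t : ℝ) - 1 / (n + 1) < (⌊((n : ℝ) + 1) * t⌋₊ : ℝ) / (n + 1) := by
      rw [lt_div_iff₀ hn0, sub_mul, one_div, inv_mul_cancel₀ hn0.ne']; linarith
    constructor <;> dsimp only <;> linarith

end Labels

/-! ### Inverse limits. -/

section InverseLimit

theorem tendsto_measure_symmDiff_accumulate {X : Type*} [MeasurableSpace X] {μ : Measure X}
    [IsFiniteMeasure μ] {f : ℕ → Set X} (hf : ∀ n, NullMeasurableSet (f n) μ) :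
    Tendsto (fun n => μ (symmDiff (⋃ n, f n) (Set.accumulate f n))) atTop (𝓝 0) := by
  have h : ∀ n, μ (symmDiff (⋃ n, f n) (Set.accumulate f n)) =
      μ (⋃ n, f n) - μ (Set.accumulate f n) := fun n => by
    rw [symmDiff_of_ge (Set.accumulate_subset_iUnion n), measure_sdiff
      (Set.accumulate_subset_iUnion n) (.biUnion (Set.to_countable _) fun k _ => hf k)
      (measure_ne_top _ _)]
  simp only [h]
  have := ENNReal.Tendsto.sub (tendsto_const_nhds (x := μ (⋃ n, f n)))
    (tendsto_measure_iUnion_accumulate (μ := μ) (f := f)) (.inl (measure_ne_top _ _))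
  rwa [tsub_self] at this

variable {G : Type*} [Group G] {ι : Type*} [Preorder ι] {Y : ι → Type*} [mY : ∀ i, MeasurableSpace (Y i)] [∀ i, MulAction G (Y i)]
  {ν : ∀ i, Measure (Y i)} {p : ∀ i j, i ≤ j → Y j → Y i} {X : Type*} [MeasurableSpace X]
  [MulAction G X] {μ : Measure X} {π : ∀ i, X → Y i}

theorem IsInverseLimit.exists_measure_symmDiff_le_of_le (h : IsInverseLimit G ν p μ π)
    {A : Set X} {ε : ENNReal} {i j : ι} (hij : i ≤ j) {C : Set (Y i)}
    (hC : NullMeasurableSet C (ν i)) (hle : μ (symmDiff A (π i ⁻¹' C)) ≤ ε) :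
    ∃ C' : Set (Y j), NullMeasurableSet C' (ν j) ∧ μ (symmDiff A (π j ⁻¹' C')) ≤ ε := by
  refine ⟨p i j hij ⁻¹' C,
    (h.system.factor i j hij).measurePreserving.nullMeasurableSet_preimage C hC, ?_⟩
  refine (measure_congr ?_).le.trans hle
  refine (ae_eq_refl A).symmDiff ?_
  filter_upwards [h.compatible i j hij] with x hx
  refine propext ?_
  change p i j hij (π j x) ∈ C ↔ π i x ∈ C
  rw [hx]

variable [IsDirectedOrder ι] [Nonempty ι]

/-- Finitely many sets that are approximated by pullbacks are approximated by pullbacks from a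
single stage. -/
theorem IsInverseLimit.exists_common_stage (h : IsInverseLimit G ν p μ π) {K : Type*} [Finite K]
    {A : K → Set X} {ε : ENNReal}
    (hA : ∀ k, ∃ (i : ι) (C : Set (Y i)), NullMeasurableSet C (ν i) ∧
      μ (symmDiff (A k) (π i ⁻¹' C)) ≤ ε) :
    ∃ (i : ι) (C : K → Set (Y i)), (∀ k, NullMeasurableSet (C k) (ν i)) ∧
      ∀ k, μ (symmDiff (A k) (π i ⁻¹' (C k))) ≤ ε := by
  classical
  have := Fintype.ofFinite K
  choose i C hC hle using hA
  obtain ⟨j, hj⟩ := (Finset.univ.image i).exists_le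
  choose C' hC' hle' using fun k => h.exists_measure_symmDiff_le_of_le
    (hj (i k) (Finset.mem_image_of_mem i (Finset.mem_univ k))) (hC k) (hle k)
  exact ⟨j, C', hC', hle'⟩

/-- Measurable sets of an inverse limit are approximated by pullbacks from the stages. -/
theorem IsInverseLimit.exists_measure_symmDiff_le [IsFiniteMeasure μ]
    (h : IsInverseLimit G ν p μ π) {A : Set X} (hA : NullMeasurableSet A μ)
    {ε : ENNReal} (hε : ε ≠ 0) :
    ∃ (i : ι) (C : Set (Y i)), NullMeasurableSet C (ν i) ∧ μ (symmDiff A (π i ⁻¹' C)) ≤ ε := by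
  -- These sets form a σ-algebra containing all pullbacks of measurable sets. Directedness gives
  -- finite unions, and continuity of the finite measure gives countable ones.
  let Q : Set X → Prop := fun A => NullMeasurableSet A μ ∧ ∀ ε : ENNReal, ε ≠ 0 →
    ∃ (i : ι) (C : Set (Y i)), NullMeasurableSet C (ν i) ∧ μ (symmDiff A (π i ⁻¹' C)) ≤ ε
  have hempty : Q ∅ := ⟨nullMeasurableSet_empty, fun ε _ =>
    ⟨Classical.arbitrary ι, ∅, nullMeasurableSet_empty, by simp⟩⟩
  have hunion : ∀ {A B}, Q A → Q B → Q (A ∪ B) := fun {A B} hA hB =>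
    ⟨hA.1.union hB.1, fun ε hε => by
      obtain ⟨i, C, hC, hle⟩ := h.exists_common_stage (K := Bool) (A := fun b => cond b A B)
        (ε := ε / 2) (by
          have hε2 : ε / 2 ≠ 0 := by simpa using hε
          rintro (_ | _)
          exacts [hB.2 _ hε2, hA.2 _ hε2])
      refine ⟨i, C true ∪ C false, (hC true).union (hC false), ?_⟩
      rw [Set.preimage_union]
      calc _ ≤ μ (symmDiff A (π i ⁻¹' C true) ∪ symmDiff B (π i ⁻¹' C false)) :=
            measure_mono Set.union_symmDiff_union_subset
        _ ≤ _ := measure_union_le _ _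
        _ ≤ ε / 2 + ε / 2 := add_le_add (hle true) (hle false)
        _ = ε := ENNReal.add_halves ε⟩
  have hiUnion : ∀ f : ℕ → Set X, (∀ n, Q (f n)) → Q (⋃ n, f n) := fun f hf => by
    refine ⟨.iUnion fun n => (hf n).1, fun ε hε => ?_⟩
    have hacc : ∀ n, Q (Set.accumulate f n) := fun n => by
      induction n with
      | zero => simpa [Set.accumulate] using hf 0
      | succ n ih => rw [Set.accumulate_succ]; exact hunion ih (hf _)
    have hε2 : ε / 2 ≠ 0 := by simpa using hε
    obtain ⟨n, hn⟩ := ((tendsto_measure_symmDiff_accumulate fun n =>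
      (hf n).1).eventually_lt_const (pos_iff_ne_zero.2 hε2)).exists
    obtain ⟨i, C, hC, hle⟩ := (hacc n).2 (ε / 2) hε2
    exact ⟨i, C, hC, (measure_symmDiff_le _ (Set.accumulate f n) _).trans
      ((add_le_add hn.le hle).trans (ENNReal.add_halves ε).le)⟩
  have hcompl : ∀ A, Q A → Q Aᶜ := fun A hA => ⟨hA.1.compl, fun ε hε => by
    obtain ⟨i, C, hC, hle⟩ := hA.2 ε hε
    exact ⟨i, Cᶜ, hC.compl, by rwa [Set.preimage_compl, compl_symmDiff_compl]⟩⟩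
  have hsup : ∀ B, MeasurableSet[⨆ i, (mY i).comap (π i)] B → Q B := by
    have hle : ⨆ i, (mY i).comap (π i) ≤ MeasurableSpace.mk Q hempty hcompl hiUnion := by
      refine iSup_le fun i => ?_
      rintro _ ⟨C, hC, rfl⟩
      exact ⟨(h.factor i).measurePreserving.nullMeasurableSet_preimage C hC.nullMeasurableSet,
        fun ε _ => ⟨i, C, hC.nullMeasurableSet, by simp⟩⟩
    exact hle
  obtain ⟨B, hB, hAB⟩ := h.generates A hA
  obtain ⟨i, C, hC, hle⟩ := (hsup B hB).2 ε hε
  exact ⟨i, C, hC, (measure_congr (hAB.symmDiff (ae_eq_refl _))).le.trans hle⟩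

variable [Countable G] {d : ℕ → ℕ} {σ : ∀ i, G → Equiv.Perm (Fin (d i))}

/-- Discretize `θ` into `r + 1` level sets and approximate each within `ε / (r + 1)` from one common
stage. Off the union of the symmetric differences, of measure at most `ε`, the labels read at that
stage are the true ones. -/
theorem IsInverseLimit.isStronglySofic (hσ : IsSoficApproximation σ)
    (h : IsInverseLimit G ν p μ π) (hν : ∀ i, IsPMPAction G (ν i)) (hμ : IsPMPAction G μ)
    (hs : ∀ i, IsStronglySofic σ (ν i)) : IsStronglySofic σ μ := by
  have := hμ.standard.1
  refine hμ.isStronglySofic_of_isApproximable fun θ hθ =>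
    isApproximable_itineraryLaw_of_forall_close hμ.measurePreserving hθ fun ε hε => ?_
  obtain ⟨r, u, v, hu, huv⟩ := unitInterval.exists_measurable_discretization hε
  have huθ : AEMeasurable (u ∘ θ) μ := hu.comp_aemeasurable hθ
  obtain ⟨i, C, hC, hle⟩ := h.exists_common_stage
    (A := fun k => (u ∘ θ) ⁻¹' {k}) (ε := ENNReal.ofReal ε / (r + 1)) fun k =>
      h.exists_measure_symmDiff_le (huθ.nullMeasurable (measurableSet_singleton k))
        (ENNReal.div_ne_zero.2 ⟨by simpa using hε, by finiteness⟩)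
  have hv : Measurable v := Measurable.of_discrete
  have hθ' : AEMeasurable (v ∘ familyLabel C) (ν i) :=
    hv.comp_aemeasurable (aemeasurable_familyLabel hC)
  refine ⟨(v ∘ familyLabel C) ∘ π i, (h.factor i).measurePreserving.aemeasurable_comp hθ', ?_, ?_⟩
  · rw [itineraryLaw_comp (hν i).measurePreserving (h.factor i) hθ']
    exact (hs i).isApproximable hσ (hν i).measurePreserving hθ'
  · calc μ {x | ε ≤ dist (((v ∘ familyLabel C) ∘ π i) x) (θ x)}
        ≤ μ (⋃ k, symmDiff ((u ∘ θ) ⁻¹' {k}) (π i ⁻¹' (C k))) := measure_mono fun x hx => by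
          by_contra hcon
          simp only [Set.mem_iUnion, not_exists, Set.mem_symmDiff, not_or, not_and, not_not] at hcon
          have hlabel : familyLabel C (π i x) = u (θ x) :=
            familyLabel_eq ((hcon _).1 rfl) fun l hl hmem => hl ((hcon l).2 hmem).symm
          have hx' : ε ≤ dist (v (familyLabel C (π i x))) (θ x) := hx
          rw [hlabel] at hx'
          exact hx'.not_gt (huv _)
      _ ≤ ∑ k, μ (symmDiff ((u ∘ θ) ⁻¹' {k}) (π i ⁻¹' (C k))) := measure_iUnion_fintype_le _ _
      _ ≤ ∑ _k : Fin (r + 1), ENNReal.ofReal ε / (r + 1) := Finset.sum_le_sum fun k _ => hle k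
      _ = ENNReal.ofReal ε := by
          simp only [Finset.sum_const, Finset.card_univ, Fintype.card_fin, nsmul_eq_mul]
          push_cast
          exact ENNReal.mul_div_cancel (by positivity) (by finiteness)

end InverseLimit

/-! ### Dependence on finitely many coordinates. -/

section Truncation

variable {G : Type*} [Countable G]

/-- The point of the shift which agrees with `z` on `F` and vanishes elsewhere. -/
noncomputable def ShiftSpace.truncate (F : Finset G) (z : ShiftSpace G) : ShiftSpace G :=
  open Classical in ShiftSpace.mk fun g => if g ∈ F then ShiftSpace.eval g z else 0

theorem ShiftSpace.continuous_truncate (F : Finset G) :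
    Continuous (ShiftSpace.truncate F) :=
  ShiftSpace.continuous_of_eval fun g => by
    by_cases hg : g ∈ F
    · simpa [ShiftSpace.truncate, hg] using ShiftSpace.continuous_eval g
    · simpa [ShiftSpace.truncate, hg] using continuous_const

theorem ShiftSpace.tendstoUniformly_truncate :
    TendstoUniformly (ShiftSpace.truncate (G := G)) id atTop := by
  classical
  rw [tendstoUniformly_iff_tendsto]
  have hu : uniformity (ShiftSpace G) = ⨅ k : Shrink.{0} G,
      Filter.comap (fun a : ShiftSpace G × ShiftSpace G => (a.1 k, a.2 k)) (uniformity unitInterval) :=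
    Pi.uniformity (fun _ : Shrink.{0} G => unitInterval)
  rw [hu, tendsto_iInf]
  intro k
  rw [tendsto_comap_iff]
  intro U hU
  have hev : ∀ᶠ F : Finset G in atTop, (equivShrink.{0} G).symm k ∈ F := by
    filter_upwards [eventually_ge_atTop {(equivShrink.{0} G).symm k}] with F hF
    exact hF (Finset.mem_singleton_self _)
  refine Filter.mem_map.2
    (mem_of_superset (hev.prod_inl (⊤ : Filter (ShiftSpace G))) fun q hq => ?_)
  replace hq : (equivShrink.{0} G).symm k ∈ q.1 := hq
  have heq : ShiftSpace.truncate q.1 q.2 k = q.2 k := by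
    simp [ShiftSpace.truncate, ShiftSpace.mk, ShiftSpace.eval, hq]
  change (q.2 k, ShiftSpace.truncate q.1 q.2 k) ∈ U
  rw [heq]
  exact refl_mem_uniformity hU

/-- Truncations converge uniformly to the identity, and `f` is uniformly continuous by compactness.
-/
theorem ShiftSpace.eventually_abs_sub_truncate_le (f : C(ShiftSpace G × ShiftSpace G, ℝ)) {δ : ℝ}
    (hδ : 0 < δ) : ∀ᶠ F : Finset G in atTop, ∀ w : ShiftSpace G × ShiftSpace G,
      |f w - f (ShiftSpace.truncate F w.1, ShiftSpace.truncate F w.2)| ≤ δ := by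
  have hT := (ShiftSpace.tendstoUniformly_truncate (G := G))
  have h := (CompactSpace.uniformContinuous_of_continuous f.continuous).comp_tendstoUniformly
    ((hT.comp Prod.fst).prodMk (hT.comp Prod.snd))
  filter_upwards [(tendsto_id.prodMk tendsto_id).eventually
    (Metric.tendstoUniformly_iff.1 h δ hδ)] with F hF w
  exact (hF w).le

end Truncation

/-! ### Transfer of window statistics under weak containment. -/

section Windows

/-- Equal totals force any excess of `q` over `p` at `a` to be offset by deficits at the other
points, each at most `t`. -/
theorem abs_sub_le_card_mul_of_sum_eq {T : Type*} [Fintype T] {p q : T → ℝ} {t : ℝ}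
    (hsum : ∑ a, p a = ∑ a, q a) (h : ∀ a, p a - t ≤ q a) (ht : 0 ≤ t) (a : T) :
    |p a - q a| ≤ Fintype.card T * t := by
  classical
  have hcard : (1 : ℝ) ≤ Fintype.card T := by
    exact_mod_cast Fintype.card_pos_iff.2 ⟨a⟩
  have h1 : ∑ b ∈ Finset.univ.erase a, (p b - q b) ≤ (Fintype.card T - 1) * t := by
    calc ∑ b ∈ Finset.univ.erase a, (p b - q b) ≤ ∑ _b ∈ Finset.univ.erase a, t :=
          Finset.sum_le_sum fun b _ => by linarith [h b]
      _ = (Fintype.card T - 1) * t := by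
          rw [Finset.sum_const, Finset.card_erase_of_mem (Finset.mem_univ a), nsmul_eq_mul,
            Finset.card_univ, Nat.cast_pred (Fintype.card_pos_iff.2 ⟨a⟩)]
  have h2 : ∑ b, (p b - q b) = 0 := by rw [Finset.sum_sub_distrib, hsum, sub_self]
  rw [← Finset.add_sum_erase _ _ (Finset.mem_univ a)] at h2
  rw [abs_le]
  constructor <;> nlinarith [h a]

variable {G : Type*} [Group G] {X Y : Type*} [MeasurableSpace X] [MeasurableSpace Y] [MulAction G X]
  [MulAction G Y] {μ : Measure X} {ν : Measure Y}

/-- The pattern of a labeling seen from a point through a finite window. -/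
def windowPattern {K : Type*} (F : Finset G) (κ : X → K) (x : X) : F → K := fun g => κ ((g : G) • x)

theorem aemeasurable_windowPattern {K : Type*} [MeasurableSpace K]
    [MeasurableSpace.CountablyGenerated K]
    (hμ : ∀ g : G, NullMeasurePreserving (fun x : X => g • x) μ μ) (F : Finset G) {κ : X → K}
    (hκ : AEMeasurable κ μ) : AEMeasurable (windowPattern F κ) μ :=
  aemeasurable_pi_lambda _ fun g => (hμ g).aemeasurable_comp hκ

theorem WeaklyContained.exists_of_fintype (h : WeaklyContained G ν μ) {T : Type*} [Finite T]
    {A : T → Set Y} (hA : ∀ k, NullMeasurableSet (A k) ν) (F : Finset G) {ε : ℝ} (hε : 0 < ε) :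
    ∃ B : T → Set X, (∀ k, NullMeasurableSet (B k) μ) ∧
      ∀ g ∈ F, ∀ k l, |ν.real ((g • A k) ∩ A l) - μ.real ((g • B k) ∩ B l)| < ε := by
  obtain ⟨n, ⟨e⟩⟩ := Finite.exists_equiv_fin T
  obtain ⟨B, hB, hclose⟩ := h n (fun k => A (e.symm k)) (fun k => hA _) F ε hε
  exact ⟨fun k => B (e k), fun k => hB _, fun g hg k l => by simpa using hclose g hg (e k) (e l)⟩

/-- Weak containment transfers the window statistics of finite labelings, one-sided version. -/
theorem WeaklyContained.exists_sub_le_windowPattern [IsProbabilityMeasure μ]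
    [IsProbabilityMeasure ν] (h : WeaklyContained G ν μ)
    (hμ : ∀ g : G, NullMeasurePreserving (fun x : X => g • x) μ μ)
    (hν : ∀ g : G, NullMeasurePreserving (fun y : Y => g • y) ν ν) {K : Type*} [Fintype K]
    [Nonempty K] [MeasurableSpace K] [MeasurableSingletonClass K] {κ : Y → K}
    (hκ : AEMeasurable κ ν) (F : Finset G) {t : ℝ} (ht : 0 < t) :
    ∃ κ' : X → K, AEMeasurable κ' μ ∧ ∀ a : F → K,
      ν.real {y | windowPattern F κ y = a} - t ≤ μ.real {x | windowPattern F κ' x = a} := by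
  classical
  -- Weak containment compares only pairwise intersections, while a pattern is an intersection over
  -- all of `F`. Including the pattern sets makes pairwise data enough: each pattern set lies in the
  -- translates of its own label sets and misses the others.
  let A : K ⊕ (F → K) → Set Y :=
    Sum.elim (fun k => κ ⁻¹' {k}) fun a => windowPattern F κ ⁻¹' {a}
  have hA : ∀ k, NullMeasurableSet (A k) ν := by
    rintro (k | a)
    · exact hκ.nullMeasurable (measurableSet_singleton k)
    · exact (aemeasurable_windowPattern hν F hκ).nullMeasurable (measurableSet_singleton a)
  -- The count of errors of size `ε`: one for the measure of the pattern set and, for each `g`, two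
  -- for missing the right label and one per wrong label.
  set c : ℝ := 1 + F.card * (2 + Fintype.card K) with hc
  have hc0 : 0 < c := by positivity
  set ε := t / c with hε
  have hε0 : 0 < ε := by positivity
  obtain ⟨B, hB, hclose⟩ := h.exists_of_fintype hA (insert 1 F⁻¹) hε0
  refine ⟨familyLabel fun k => B (Sum.inl k), aemeasurable_familyLabel fun k => hB _, fun a => ?_⟩
  set κ' := familyLabel fun k => B (Sum.inl k) with hκ'
  have hpre : ∀ (g : G) (k : K), g⁻¹ • B (Sum.inl k) = (fun x => g • x) ⁻¹' B (Sum.inl k) :=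
    fun g k => by ext x; exact Set.mem_inv_smul_set_iff
  have hpreA : ∀ (g : G) (k : K), g⁻¹ • A (Sum.inl k) = (fun x => g • x) ⁻¹' A (Sum.inl k) :=
    fun g k => by ext x; exact Set.mem_inv_smul_set_iff
  have hnull : ∀ (g : G) (k : K), NullMeasurableSet (g⁻¹ • B (Sum.inl k)) μ := fun g k => by
    rw [hpre]; exact (hμ g).nullMeasurableSet_preimage _ (hB _)
  have hBa : ν.real (A (Sum.inr a)) - ε ≤ μ.real (B (Sum.inr a)) := by
    have := (abs_lt.1 (hclose 1 (Finset.mem_insert_self _ _) (Sum.inr a) (Sum.inr a))).2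
    simp only [one_smul, Set.inter_self] at this
    linarith
  have hBa' : μ.real (B (Sum.inr a)) ≤ ν.real (A (Sum.inr a)) + ε := by
    have := (abs_lt.1 (hclose 1 (Finset.mem_insert_self _ _) (Sum.inr a) (Sum.inr a))).1
    simp only [one_smul, Set.inter_self] at this
    linarith
  have hmem : ∀ g : F, (g : G)⁻¹ ∈ insert 1 F⁻¹ := fun g =>
    Finset.mem_insert_of_mem (Finset.inv_mem_inv g.2)
  have hgood : ∀ g : F, μ.real (B (Sum.inr a) \ ((g : G)⁻¹ • B (Sum.inl (a g)))) ≤ 2 * ε := by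
    intro g
    have h1 := (abs_lt.1 (hclose _ (hmem g) (Sum.inl (a g)) (Sum.inr a))).2
    have h2 : ((g : G)⁻¹ • A (Sum.inl (a g))) ∩ A (Sum.inr a) = A (Sum.inr a) := by
      rw [hpreA]
      refine Set.inter_eq_right.2 fun y hy => ?_
      have hy' : windowPattern F κ y = a := hy
      exact congrFun hy' g
    have h3 := measureReal_inter_add_sdiff₀ (μ := μ) (s := B (Sum.inr a)) (hnull g (a g))
    rw [h2] at h1
    rw [Set.inter_comm] at h3
    linarith
  have hbad : ∀ (g : F) (l : K), l ≠ a g →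
      μ.real (((g : G)⁻¹ • B (Sum.inl l)) ∩ B (Sum.inr a)) ≤ ε := by
    intro g l hl
    have h1 := (abs_lt.1 (hclose _ (hmem g) (Sum.inl l) (Sum.inr a))).1
    have h2 : ((g : G)⁻¹ • A (Sum.inl l)) ∩ A (Sum.inr a) = ∅ := by
      rw [hpreA]
      refine Set.eq_empty_of_forall_notMem fun y hy => hl ?_
      have hy1 : κ ((g : G) • y) = l := hy.1
      have hy2 : windowPattern F κ y = a := hy.2
      rw [← hy1, ← hy2]
      rfl
    rw [h2, measureReal_empty] at h1
    linarith
  -- The sets `B` need not form a partition. Off the error set, `g • x` lies in the right label set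
  -- and in no other, so its label is unambiguous.
  have hsub : B (Sum.inr a) ⊆ {x | windowPattern F κ' x = a} ∪ ⋃ g : F,
      (B (Sum.inr a) \ ((g : G)⁻¹ • B (Sum.inl (a g))) ∪
        ⋃ l : K, {x | l ≠ a g ∧ x ∈ ((g : G)⁻¹ • B (Sum.inl l)) ∩ B (Sum.inr a)}) := by
    intro x hx
    by_contra hcon
    simp only [Set.mem_union, Set.mem_iUnion, not_or, not_exists, Set.mem_sdiff, not_and,
      not_not, Set.mem_ofPred_eq, Set.mem_inter_iff] at hcon
    refine hcon.1 (funext fun g => ?_)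
    have h1 := (hcon.2 g).1 hx
    rw [hpre] at h1
    refine familyLabel_eq h1 fun l hl hmem => (hcon.2 g).2 l hl ?_ hx
    rw [hpre]
    exact hmem
  have hle : μ.real (B (Sum.inr a)) ≤ μ.real {x | windowPattern F κ' x = a} +
      ∑ _g : F, (2 * ε + ∑ _l : K, ε) := by
    refine (measureReal_mono hsub).trans ((measureReal_union_le _ _).trans ?_)
    gcongr
    refine (measureReal_iUnion_fintype_le _).trans (Finset.sum_le_sum fun g _ => ?_)
    refine (measureReal_union_le _ _).trans ?_
    gcongr
    · exact hgood g
    · refine (measureReal_iUnion_fintype_le _).trans (Finset.sum_le_sum fun l _ => ?_)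
      by_cases hl : l = a g
      · simp [hl, hε0.le]
      · refine le_trans (measureReal_mono fun x hx => hx.2) (hbad g l hl)
  have hAa : ν.real {y | windowPattern F κ y = a} = ν.real (A (Sum.inr a)) := rfl
  have htc : t = ε * c := by rw [hε]; field_simp
  simp only [Finset.sum_const, Finset.card_univ, Fintype.card_coe, nsmul_eq_mul] at hle
  rw [hAa, htc, hc]
  linarith

/-- Weak containment transfers the window statistics of finite labelings. -/
theorem WeaklyContained.exists_abs_sub_windowPattern_le [IsProbabilityMeasure μ]
    [IsProbabilityMeasure ν] (h : WeaklyContained G ν μ)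
    (hμ : ∀ g : G, NullMeasurePreserving (fun x : X => g • x) μ μ)
    (hν : ∀ g : G, NullMeasurePreserving (fun y : Y => g • y) ν ν) {K : Type*} [Fintype K]
    [Nonempty K] [MeasurableSpace K] [MeasurableSingletonClass K] {κ : Y → K}
    (hκ : AEMeasurable κ ν) (F : Finset G) {t : ℝ} (ht : 0 < t) :
    ∃ κ' : X → K, AEMeasurable κ' μ ∧ ∀ a : F → K,
      |(ν.map (windowPattern F κ)).real {a} - (μ.map (windowPattern F κ')).real {a}| ≤ t := by
  classical
  have hN : (0 : ℝ) < Fintype.card (F → K) := by exact_mod_cast Fintype.card_pos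
  obtain ⟨κ', hκ', hle⟩ := h.exists_sub_le_windowPattern hμ hν hκ F (div_pos ht hN)
  have hw := aemeasurable_windowPattern hν F hκ
  have hw' := aemeasurable_windowPattern hμ F hκ'
  have := Measure.isProbabilityMeasure_map hw
  have := Measure.isProbabilityMeasure_map hw'
  refine ⟨κ', hκ', fun a => ?_⟩
  refine (abs_sub_le_card_mul_of_sum_eq (p := fun a => (ν.map (windowPattern F κ)).real {a})
    (q := fun a => (μ.map (windowPattern F κ')).real {a}) ?_ (fun b => ?_)
    (div_pos ht hN).le a).trans (mul_div_cancel₀ t hN.ne').le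
  · rw [sum_measureReal_singleton, sum_measureReal_singleton]
    simp
  · rw [map_measureReal_apply_of_aemeasurable hw (measurableSet_singleton b),
      map_measureReal_apply_of_aemeasurable hw' (measurableSet_singleton b)]
    exact hle b

end Windows

/-! ### Weakly contained actions. -/

section WeakContainment

variable {G : Type*} [Countable G] [Group G] {X Y : Type*} [MeasurableSpace X] [MeasurableSpace Y]
  [MulAction G X] [MulAction G Y] {μ : Measure X} {ν : Measure Y}

theorem abs_integral_prod_sub_le {T : Type*} [Fintype T] [MeasurableSpace T]
    [MeasurableSingletonClass T] (P Q : Measure T) [IsProbabilityMeasure P]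
    [IsProbabilityMeasure Q] {f : T × T → ℝ} {M t : ℝ} (hf : ∀ w, |f w| ≤ M)
    (h : ∀ a, |P.real {a} - Q.real {a}| ≤ t) :
    |∫ w, f w ∂(P.prod P) - ∫ w, f w ∂(Q.prod Q)| ≤ Fintype.card (T × T) * (2 * t * M) := by
  have hone : ∀ (R : Measure T) [IsProbabilityMeasure R] (a : T), 0 ≤ R.real {a} ∧ R.real {a} ≤ 1 :=
    fun R _ a => ⟨measureReal_nonneg, measureReal_le_one⟩
  have hprod : ∀ (R : Measure T) [IsProbabilityMeasure R] (w : T × T),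
      (R.prod R).real {w} = R.real {w.1} * R.real {w.2} := fun R _ w => by
    rw [← measureReal_prod_prod, Set.singleton_prod_singleton]
  rw [integral_fintype .of_finite, integral_fintype .of_finite, ← Finset.sum_sub_distrib]
  refine (Finset.abs_sum_le_sum_abs _ _).trans
    ((Finset.sum_le_sum fun w _ => ?_).trans (by simp : ∑ _w : T × T, 2 * t * M ≤ _))
  rw [hprod, hprod, ← sub_smul, smul_eq_mul, abs_mul]
  have h1 : |P.real {w.1} * P.real {w.2} - Q.real {w.1} * Q.real {w.2}| ≤ 2 * t := by
    have e : P.real {w.1} * P.real {w.2} - Q.real {w.1} * Q.real {w.2} =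
      P.real {w.1} * (P.real {w.2} - Q.real {w.2}) +
        (P.real {w.1} - Q.real {w.1}) * Q.real {w.2} := by ring
    rw [e]
    refine (abs_add_le _ _).trans ?_
    rw [abs_mul, abs_mul, abs_of_nonneg (hone P w.1).1, abs_of_nonneg (hone Q w.2).1]
    have ht : 0 ≤ t := (abs_nonneg _).trans (h w.1)
    have := mul_le_mul (hone P w.1).2 (h w.2) (abs_nonneg _) zero_le_one
    have := mul_le_mul (h w.1) (hone Q w.2).2 (hone Q w.2).1 ht
    linarith
  exact mul_le_mul h1 (hf w) (abs_nonneg _) ((abs_nonneg _).trans h1)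

/-- The point of the shift determined by a finite pattern. -/
noncomputable def patternPoint {K : Type*} (v : K → unitInterval) (F : Finset G) (a : F → K) :
    ShiftSpace G :=
  open Classical in ShiftSpace.mk fun g => if h : g ∈ F then v (a ⟨g, h⟩) else 0

theorem truncate_itinerary {X : Type*} [MulAction G X] {K : Type*} (v : K → unitInterval) (F : Finset G) (κ : X → K) (x : X) :
    ShiftSpace.truncate F (itinerary G (v ∘ κ) x) = patternPoint v F (windowPattern F κ x) := by
  apply ShiftSpace.ext
  intro g
  by_cases hg : g ∈ F <;> simp [ShiftSpace.truncate, patternPoint, windowPattern, hg]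

theorem integral_prod_comp_eq {T Z : Type*} [MeasurableSpace T] [TopologicalSpace Z]
    [MeasurableSpace Z] [OpensMeasurableSpace (Z × Z)] (P : Measure T) [IsProbabilityMeasure P]
    (f : C(Z × Z, ℝ)) {q : T → Z} (hq : Measurable q) :
    ∫ w, f (q w.1, q w.2) ∂(P.prod P) = ∫ w, f w ∂((P.map q).prod (P.map q)) := by
  rw [Measure.map_prod_map _ _ hq hq, integral_map (hq.prodMap hq).aemeasurable
    f.continuous.measurable.aestronglyMeasurable]
  rfl

/-- The statistics of a finite labeling are computed by its window patterns, up to a small error. -/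
theorem abs_integral_itineraryLaw_sub_le [IsProbabilityMeasure μ]
    (hμ : ∀ g : G, NullMeasurePreserving (fun x : X => g • x) μ μ) {K : Type*} [Finite K]
    [MeasurableSpace K] [MeasurableSingletonClass K] (v : K → unitInterval) {κ : X → K}
    (hκ : AEMeasurable κ μ) (F : Finset G) (f : C(ShiftSpace G × ShiftSpace G, ℝ)) {δ : ℝ}
    (hf : ∀ w : ShiftSpace G × ShiftSpace G,
      |f w - f (ShiftSpace.truncate F w.1, ShiftSpace.truncate F w.2)| ≤ δ) :
    |∫ w, f w ∂((itineraryLaw G μ (v ∘ κ)).prod (itineraryLaw G μ (v ∘ κ))) -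
      ∫ w, f (patternPoint v F w.1, patternPoint v F w.2)
        ∂((μ.map (windowPattern F κ)).prod (μ.map (windowPattern F κ)))| ≤ δ := by
  have hθ : AEMeasurable (v ∘ κ) μ := (Measurable.of_discrete (f := v)).comp_aemeasurable hκ
  have hI := aemeasurable_itinerary hμ hθ
  have hW := aemeasurable_windowPattern hμ F hκ
  have htr : Measurable (ShiftSpace.truncate F) :=
    (ShiftSpace.continuous_truncate F).measurable
  have hpp : Measurable (patternPoint v F) := .of_discrete
  have := Measure.isProbabilityMeasure_map hW
  have : IsProbabilityMeasure (itineraryLaw G μ (v ∘ κ)) := Measure.isProbabilityMeasure_map hI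
  have hmap : (itineraryLaw G μ (v ∘ κ)).map (ShiftSpace.truncate F) =
      (μ.map (windowPattern F κ)).map (patternPoint v F) := by
    rw [itineraryLaw, AEMeasurable.map_map_of_aemeasurable htr.aemeasurable hI,
      AEMeasurable.map_map_of_aemeasurable hpp.aemeasurable hW]
    congr 1
    funext x
    exact truncate_itinerary v F κ x
  have hmid : ∫ w, f (patternPoint v F w.1, patternPoint v F w.2)
        ∂((μ.map (windowPattern F κ)).prod (μ.map (windowPattern F κ))) =
      ∫ w, f (ShiftSpace.truncate F w.1, ShiftSpace.truncate F w.2)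
        ∂((itineraryLaw G μ (v ∘ κ)).prod (itineraryLaw G μ (v ∘ κ))) := by
    rw [integral_prod_comp_eq _ _ hpp, integral_prod_comp_eq _ _ htr, hmap]
  rw [hmid, ← integral_sub (integrable_continuousMap _ f aemeasurable_id')
    (integrable_continuousMap _ f (u := fun w : ShiftSpace G × ShiftSpace G =>
      (ShiftSpace.truncate F w.1, ShiftSpace.truncate F w.2)) (htr.prodMap htr).aemeasurable)]
  simpa using norm_integral_le_of_norm_le_const
    (μ := (itineraryLaw G μ (v ∘ κ)).prod (itineraryLaw G μ (v ∘ κ)))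
    (f := fun w => f w - f (ShiftSpace.truncate F w.1, ShiftSpace.truncate F w.2)) (.of_forall hf)

/-- Discretization reduces to finite labelings of `Y`. For given test functions, truncation leaves
only the pattern law in a finite window to match, and weak containment supplies a labeling of `X`
with nearly that law. -/
theorem WeaklyContained.isStronglySofic {d : ℕ → ℕ} {σ : ∀ i, G → Equiv.Perm (Fin (d i))}
    (hσ : IsSoficApproximation σ) (h : WeaklyContained G ν μ) (hμ : IsPMPAction G μ)
    (hν : IsPMPAction G ν) (hs : IsStronglySofic σ μ) : IsStronglySofic σ ν := by
  classical
  have := hμ.standard.1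
  have := hν.standard.1
  refine hν.isStronglySofic_of_isApproximable fun θ hθ =>
    isApproximable_itineraryLaw_of_forall_close hν.measurePreserving hθ fun ε hε => ?_
  obtain ⟨r, u, v, hu, huv⟩ := unitInterval.exists_measurable_discretization hε
  have hκ : AEMeasurable (u ∘ θ) ν := hu.comp_aemeasurable hθ
  have hv : Measurable v := Measurable.of_discrete
  refine ⟨v ∘ u ∘ θ, hv.comp_aemeasurable hκ, .of_forall_close fun L δ hδ => ?_, ?_⟩
  -- One third of `δ` goes to truncation on each side and one third to comparing pattern laws.
  · obtain ⟨F, hF⟩ := ((Finset.eventually_all L).2 fun f _ =>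
      ShiftSpace.eventually_abs_sub_truncate_le f (show 0 < δ / 3 by positivity)).exists
    set M : ℝ := ∑ f ∈ L, ‖f‖ with hM
    have hM0 : 0 ≤ M := Finset.sum_nonneg fun f _ => norm_nonneg f
    have hfM : ∀ f ∈ L, ‖f‖ ≤ M := fun f hf =>
      Finset.single_le_sum (fun f _ => norm_nonneg f) hf
    obtain ⟨N, hN⟩ : ∃ N : ℝ,
        N = Fintype.card ((F → Fin (r + 1)) × (F → Fin (r + 1))) := ⟨_, rfl⟩
    have hN0 : 0 < N := by rw [hN]; exact_mod_cast Fintype.card_pos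
    -- Chosen against the bound in `abs_integral_prod_sub_le`; `M + 1` avoids division by zero.
    set t := δ / 3 / (N * (2 * (M + 1))) with ht
    have ht0 : 0 < t := by positivity
    have htN : N * (2 * t * M) ≤ δ / 3 := by
      calc N * (2 * t * M) ≤ N * (2 * t * (M + 1)) := by gcongr; linarith
        _ = δ / 3 := by rw [ht]; field_simp
    obtain ⟨κ', hκ', hclose⟩ := h.exists_abs_sub_windowPattern_le hμ.measurePreserving
      hν.measurePreserving hκ F ht0
    refine ⟨itineraryLaw G μ (v ∘ κ'),
      hs.isApproximable hσ hμ.measurePreserving (hv.comp_aemeasurable hκ'), fun f hf => ?_⟩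
    have h1 := abs_integral_itineraryLaw_sub_le hμ.measurePreserving v hκ' F f (hF f hf)
    have h2 := abs_integral_itineraryLaw_sub_le hν.measurePreserving v hκ F f (hF f hf)
    have := Measure.isProbabilityMeasure_map
      (aemeasurable_windowPattern hμ.measurePreserving F hκ')
    have := Measure.isProbabilityMeasure_map
      (aemeasurable_windowPattern hν.measurePreserving F hκ)
    have h3 := (abs_integral_prod_sub_le (ν.map (windowPattern F (u ∘ θ)))
      (μ.map (windowPattern F κ'))
      (f := fun w => f (patternPoint v F w.1, patternPoint v F w.2))
      (fun w => (f.norm_coe_le_norm _).trans (hfM f hf)) hclose).trans (hN ▸ htN)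
    rw [abs_le] at h1 h2 h3 ⊢
    constructor <;> linarith
  · have : {y | ε ≤ dist ((v ∘ u ∘ θ) y) (θ y)} = ∅ :=
      Set.eq_empty_of_forall_notMem fun y hy => (huv (θ y)).not_ge hy
    rw [this]
    simp

end WeakContainment

theorem theorem1p2 {G : Type*} [Group G] [Countable G] {d : ℕ → ℕ}
    (σ : ∀ i, G → Equiv.Perm (Fin (d i))) (hσ : IsSoficApproximation σ) :
    -- inverse limits of strongly sofic actions are strongly sofic
    (∀ {ι : Type*} [Preorder ι] [IsDirectedOrder ι] [Nonempty ι]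
        {Y : ι → Type*} [∀ i, MeasurableSpace (Y i)] [∀ i, MulAction G (Y i)]
        (ν : ∀ i, Measure (Y i)) (p : ∀ i j, i ≤ j → Y j → Y i)
        {X : Type*} [MeasurableSpace X] [MulAction G X] (μ : Measure X) (π : ∀ i, X → Y i),
        (∀ i, IsPMPAction G (ν i)) → IsPMPAction G μ → IsInverseLimit G ν p μ π →
        (∀ i, IsStronglySofic σ (ν i)) → IsStronglySofic σ μ) ∧
    -- actions weakly contained in a strongly sofic action are strongly sofic
    (∀ {X : Type*} [MeasurableSpace X] [MulAction G X] (μ : Measure X)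
        {Y : Type*} [MeasurableSpace Y] [MulAction G Y] (ν : Measure Y),
        IsPMPAction G μ → IsPMPAction G ν → WeaklyContained G ν μ →
        IsStronglySofic σ μ → IsStronglySofic σ ν) := by
  refine ⟨?_, ?_⟩
  · intro ι _ _ _ Y _ _ ν p X _ _ μ π hν hμ hlim hs
    exact hlim.isStronglySofic hσ hν hμ hs
  · intro X _ _ μ Y _ _ ν hμ hν hwc hs
    exact hwc.isStronglySofic hσ hμ hν hs
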